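/- Let $L_2(0,1]$ be the complex Hilbert space of square-integrable functions on $(0,1]$ with Lebesgue measure. Let $G=\chi_{(0,1]}$, $G_{n,k}(x)=2^{n/2}G(2^nx-k)$, $H=(G_{1,0}-G_{1,1})/\sqrt2$ and $H_{n,k}(x)=2^{n/2}H(2^nx-k)$. Put $V_n=\operatorname{span}\{G_{n,k}:0\le k<2^n\}$ and $W_n=\operatorname{span}\{H_{n,k}:0\le k<2^n\}$. Let $\mathcal T_H:L_2(0,1]\to\ell_2$ be the Haar transform, i.e. the unitary map sending $f$ to its coefficients $c_0=\int_0^1 f$ and $c_{n,k}=\int_0^1 fH_{n,k}$ ($n\ge0$, $0\le k<2^n$) with respect to the Haar basis. The basis state $|\epsilon_1\ldots\epsilon_n\rangle$ of $n$ qubits is identified with $G_{n,k}$, where $k=2^n\sum_{j=1}^n\epsilon_j2^{-j}$ (Borel isomorphism). An operation $U|b\rangle=\sum_a U_{ab}|a\rangle$ on the first $n$ qubits acts on functions on $(0,1]$ by translating, for all bit strings $a,b$ of length $n$, the restriction of $f$ to the dyadic interval $(k2^{-n},(k+1)2^{-n}]$ of $b$ to the dyadic interval of $a$, multiplying it by $U_{ab}$,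 and summing. Let $\sigma_+=\begin{pmatrix}0&0\\1&0\end{pmatrix}$ and $\sigma_-=\begin{pmatrix}0&1\\0&0\end{pmatrix}$, let $\sigma_\pm^k$ be the action on functions of $\sigma_\pm$ applied to the $k$-th qubit, and let $$C_\pm[f](x)=\sum_{k=1}^\infty 2^{-k}\,\sigma_\pm^k[f](x),\qquad L[f](x)=\int_0^xf(y)\,dy,\qquad L'[f](x)=\int_x^1f(y)\,dy,$$ $P_-=C_-+L$ and $P_+=C_++L'$. Then for every $f\in L_2(0,1]$ the series $C_\pm[f](x)$ converge absolutely for almost every $x$, and $P_-$, $P_+$ define bounded operators on $L_2(0,1]$ with the following properties. 1. Let $D_-^{(n)}$ be the $2^n\times2^n$ matrix of the compression of $P_-$ to $W_n$ in the basis $(H_{n,k})_{k=0}^{2^n-1}$. Then $[1]\oplus\bigoplus_{n\ge0}D_-^{(n)}$ is a bounded operator on $\ell_2$ and $$P_-=\mathcal T_H^\dagger\Big([1]\oplus\bigoplus_{n=0}^\infty D_-^{(n)}\Big)\mathcal T_H .$$ In particular $P_-V_0=V_0$ and $P_-W_n\subseteq W_n$ for all $n\ge0$. 2. $D_-^{(0)}=[0]$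 and, for $n\ge0$, $D_-^{(n+1)}=\dfrac12\begin{bmatrix}D_-^{(n)}&I\\0&D_-^{(n)}\end{bmatrix}$, where $I$ and $0$ have size $2^n\times2^n$. 3. The same holds for $P_+$: with $D_+^{(n)}$ the matrix of the compression of $P_+$ to $W_n$, the operator $[1]\oplus\bigoplus_{n\ge0}D_+^{(n)}$ is bounded on $\ell_2$, $P_+=\mathcal T_H^\dagger\big([1]\oplus\bigoplus_{n\ge0}D_+^{(n)}\big)\mathcal T_H$, $P_+V_0=V_0$ and $P_+W_n\subseteq W_n$ for all $n\ge0$, $D_+^{(0)}=[0]$, and $D_+^{(n+1)}=\dfrac12\begin{bmatrix}D_+^{(n)}&0\\I&D_+^{(n)}\end{bmatrix}$ for $n\ge0$. 4. $P_-$ and $P_+$ are adjoints of each other. -/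

import Mathlib

open MeasureTheory Set

namespace HaarQubit

noncomputable section

/-! ### The Hilbert space and the Haar system -/

/-- Lebesgue measure on `(0,1]`. -/
abbrev mu : Measure ℝ := volume.restrict (Ioc (0 : ℝ) 1)

/-- The complex Hilbert space `L₂(0,1]`. -/
abbrev L2 : Type := Lp ℂ 2 mu

/-- The function `G`, equal to `1` on `(0,1]` and to `0` elsewhere. -/
def G (x : ℝ) : ℂ := (Ioc (0 : ℝ) 1).indicator (fun _ => (1 : ℂ)) x

/-- `G_{n,k}(x) = 2^{n/2} G(2ⁿ x - k)`. -/
def Gfun (n k : ℕ) (x : ℝ) : ℂ := ((Real.sqrt 2 ^ n : ℝ) : ℂ) * G (2 ^ n * x - k)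

/-- `H = (G_{1,0} - G_{1,1}) / √2`. -/
def H (x : ℝ) : ℂ := (Gfun 1 0 x - Gfun 1 1 x) / ((Real.sqrt 2 : ℝ) : ℂ)

/-- `H_{n,k}(x) = 2^{n/2} H(2ⁿ x - k)`. -/
def Hfun (n k : ℕ) (x : ℝ) : ℂ := ((Real.sqrt 2 ^ n : ℝ) : ℂ) * H (2 ^ n * x - k)

theorem measurable_G : Measurable G :=
  measurable_const.indicator measurableSet_Ioc

theorem norm_G_le (x : ℝ) : ‖G x‖ ≤ 1 := by
  unfold G
  by_cases h : x ∈ Ioc (0 : ℝ) 1 <;> simp [h]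

theorem measurable_Gfun (n k : ℕ) : Measurable (Gfun n k) := by
  unfold Gfun
  exact measurable_const.mul (measurable_G.comp (by fun_prop))

theorem norm_Gfun_le (n k : ℕ) (x : ℝ) : ‖Gfun n k x‖ ≤ Real.sqrt 2 ^ n := by
  unfold Gfun
  rw [norm_mul, Complex.norm_real, Real.norm_of_nonneg (by positivity)]
  exact mul_le_of_le_one_right (by positivity) (norm_G_le _)

theorem measurable_H : Measurable H := by
  unfold H
  exact ((measurable_Gfun 1 0).sub (measurable_Gfun 1 1)).div_const _

theorem norm_H_le (x : ℝ) : ‖H x‖ ≤ 2 := by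
  unfold H
  have h2 : (0 : ℝ) < Real.sqrt 2 := by positivity
  rw [norm_div, Complex.norm_real, Real.norm_of_nonneg h2.le, div_le_iff₀ h2]
  have h0 := norm_Gfun_le 1 0 x
  have h1 := norm_Gfun_le 1 1 x
  have := norm_sub_le (Gfun 1 0 x) (Gfun 1 1 x)
  rw [pow_one] at h0 h1
  linarith

theorem measurable_Hfun (n k : ℕ) : Measurable (Hfun n k) := by
  unfold Hfun
  exact measurable_const.mul (measurable_H.comp (by fun_prop))

theorem norm_Hfun_le (n k : ℕ) (x : ℝ) : ‖Hfun n k x‖ ≤ Real.sqrt 2 ^ n * 2 := by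
  unfold Hfun
  rw [norm_mul, Complex.norm_real, Real.norm_of_nonneg (by positivity)]
  exact mul_le_mul_of_nonneg_left (norm_H_le _) (by positivity)

theorem memLp_Gfun (n k : ℕ) : MemLp (Gfun n k) 2 mu :=
  MemLp.of_bound (measurable_Gfun n k).aestronglyMeasurable _
    (Filter.Eventually.of_forall (norm_Gfun_le n k))

theorem memLp_Hfun (n k : ℕ) : MemLp (Hfun n k) 2 mu :=
  MemLp.of_bound (measurable_Hfun n k).aestronglyMeasurable _
    (Filter.Eventually.of_forall (norm_Hfun_le n k))

/-- `G_{n,k}` as an element of `L₂(0,1]`. -/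
def gVec (n k : ℕ) : L2 := (memLp_Gfun n k).toLp

/-- `H_{n,k}` as an element of `L₂(0,1]`. -/
def hVec (n k : ℕ) : L2 := (memLp_Hfun n k).toLp

/-- `V_n`, the span of the `G_{n,k}` with `0 ≤ k < 2ⁿ`. -/
def V (n : ℕ) : Submodule ℂ L2 := Submodule.span ℂ (Set.range fun k : Fin (2 ^ n) => gVec n k)

/-- `W_n`, the span of the `H_{n,k}` with `0 ≤ k < 2ⁿ`. -/
def W (n : ℕ) : Submodule ℂ L2 := Submodule.span ℂ (Set.range fun k : Fin (2 ^ n) => hVec n k)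

/-- Indices of the Haar basis: `none` stands for `G_{0,0}`, and `some ⟨n, k⟩` for `H_{n,k}`. -/
abbrev HaarIndex : Type := Option (Σ n : ℕ, Fin (2 ^ n))

/-- The Haar functions. -/
def haarFun : HaarIndex → ℝ → ℂ
  | none => Gfun 0 0
  | some ⟨n, k⟩ => Hfun n k

/-- The sequence space `ℓ₂` over the Haar indices. -/
abbrev l2 : Type := lp (fun _ : HaarIndex => ℂ) 2

/-- A unitary map `T : L₂(0,1] → ℓ₂` is the Haar transform if `T f` is the family of the Haar
coefficients of `f`. -/
def IsHaarTransform (T : L2 ≃ₗᵢ[ℂ] l2) : Prop :=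
  ∀ (f : L2) (i : HaarIndex), T f i = ∫ x in Ioc (0 : ℝ) 1, f x * haarFun i x

/-- The matrix, in the orthonormal basis `(H_{n,k})_k` of `W_n`, of the compression of `P`
to `W_n`. -/
def block (P : L2 →L[ℂ] L2) (n : ℕ) : Matrix (Fin (2 ^ n)) (Fin (2 ^ n)) ℂ :=
  Matrix.of fun j k => inner ℂ (hVec n j) (P (hVec n k))

/-- The action of the block diagonal matrix `[1] ⊕ ⨁ₙ D n` on sequences. -/
def blockSum (D : ∀ n : ℕ, Matrix (Fin (2 ^ n)) (Fin (2 ^ n)) ℂ) (c : HaarIndex → ℂ) :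
    HaarIndex → ℂ
  | none => c none
  | some ⟨n, k⟩ => (D n).mulVec (fun j => c (some ⟨n, j⟩)) k

/-- The subdivision of `{0, …, 2ⁿ⁺¹ - 1}` into its first and its second half. -/
def halves (n : ℕ) : Fin (2 ^ n) ⊕ Fin (2 ^ n) ≃ Fin (2 ^ (n + 1)) :=
  finSumFinEquiv.trans (finCongr (by rw [pow_succ, mul_two]))

/-! ### Gates and the Borel isomorphism -/

/-- The dyadic interval `I_{n,k}`. -/
def dyadic (n k : ℕ) : Set ℝ := Ioc ((k : ℝ) / 2 ^ n) (((k : ℝ) + 1) / 2 ^ n)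

/-- The number `k = 2ⁿ ∑_{j=1}^n ε_j / 2^j` of the bit string `ε₁ … εₙ`
(`ε₁` is the most significant bit and is stored at position `0`). -/
def bitIndex {n : ℕ} (e : Fin n → Fin 2) : ℕ := ∑ j, (e j : ℕ) * 2 ^ (j.rev : ℕ)

/-- The Borel isomorphism for `n` qubits, `|ε₁ … εₙ⟩ ↦ G_{n,k}`, where `k` is the number of the
string. A state is given by its coefficients in the basis `|ε₁ … εₙ⟩`. -/
def borel (n : ℕ) (psi : (Fin n → Fin 2) → ℂ) (x : ℝ) : ℂ := ∑ e, psi e * Gfun n (bitIndex e) x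

/-- The action on functions on `(0,1]` of an operation `U` on the first `n` qubits: for
`U |b⟩ = ∑ₐ U a b |a⟩`, the restriction of `f` to the dyadic interval of `b` is translated to the
dyadic interval of each `a` and multiplied by `U a b`. -/
def localAction {n : ℕ} (U : Matrix (Fin n → Fin 2) (Fin n → Fin 2) ℂ) (f : ℝ → ℂ) (x : ℝ) : ℂ :=
  ∑ a, ∑ b, U a b * (dyadic n (bitIndex a)).indicator
    (fun y => f (y + ((bitIndex b : ℝ) - (bitIndex a : ℝ)) / 2 ^ n)) x

theorem bitIndex_injective (n : ℕ) : Function.Injective (bitIndex (n := n)) := by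
  have key : ∀ e : Fin n → Fin 2,
      bitIndex e = (finFunctionFinEquiv (fun j => e j.rev) : Fin (2 ^ n)).val := by
    intro e
    rw [finFunctionFinEquiv_apply]
    exact (Equiv.sum_comp Fin.revPerm (fun j => (e j : ℕ) * 2 ^ (j.rev : ℕ))).symm.trans
      (by simp)
  intro e e' h
  rw [key, key] at h
  have h2 := finFunctionFinEquiv.injective (Fin.ext h)
  funext j
  simpa using congrFun h2 j.rev

theorem Gfun_of_mem {n k l : ℕ} {x : ℝ} (hx : x ∈ dyadic n k) :
    Gfun n l x = if k = l then ((Real.sqrt 2 ^ n : ℝ) : ℂ) else 0 := by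
  have hp : (0 : ℝ) < 2 ^ n := by positivity
  obtain ⟨h1, h2⟩ := hx
  rw [div_lt_iff₀ hp] at h1
  rw [le_div_iff₀ hp] at h2
  unfold Gfun G
  split_ifs with h
  · subst h
    rw [Set.indicator_of_mem, mul_one]
    constructor <;> linarith
  · rw [Set.indicator_of_notMem, mul_zero]
    rintro ⟨h3, h4⟩
    apply h
    have h5 : (k : ℝ) < l + 1 := by linarith
    have h6 : (l : ℝ) < k + 1 := by linarith
    norm_cast at h5 h6
    omega

theorem Gfun_of_notMem {n k : ℕ} {x : ℝ} (hx : x ∉ dyadic n k) : Gfun n k x = 0 := by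
  have hp : (0 : ℝ) < 2 ^ n := by positivity
  unfold Gfun G
  rw [Set.indicator_of_notMem, mul_zero]
  rintro ⟨h3, h4⟩
  apply hx
  constructor
  · rw [div_lt_iff₀ hp]; linarith
  · rw [le_div_iff₀ hp]; linarith

/-- On the functions in `V_n`, `localAction U` is the transport of `U` by the Borel isomorphism. -/
theorem localAction_borel {n : ℕ} (U : Matrix (Fin n → Fin 2) (Fin n → Fin 2) ℂ)
    (psi : (Fin n → Fin 2) → ℂ) : localAction U (borel n psi) = borel n (U.mulVec psi) := by
  have hp : (0 : ℝ) < 2 ^ n := by positivity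
  funext x
  unfold localAction
  conv_rhs => unfold borel
  refine Finset.sum_congr rfl fun a _ => ?_
  by_cases hx : x ∈ dyadic n (bitIndex a)
  · rw [Gfun_of_mem hx, if_pos rfl, Matrix.mulVec, dotProduct, Finset.sum_mul]
    refine Finset.sum_congr rfl fun b _ => ?_
    have hb : x + ((bitIndex b : ℝ) - (bitIndex a : ℝ)) / 2 ^ n ∈ dyadic n (bitIndex b) := by
      obtain ⟨h1, h2⟩ := hx
      unfold dyadic
      rw [sub_div]
      rw [add_div] at h2 ⊢
      constructor <;> linarith
    rw [Set.indicator_of_mem hx, borel, mul_assoc]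
    congr 1
    rw [Finset.sum_eq_single b]
    · rw [Gfun_of_mem hb, if_pos rfl]
    · intro c _ hc
      rw [Gfun_of_mem hb, if_neg (fun h => hc (bitIndex_injective n h).symm), mul_zero]
    · simp
  · rw [Gfun_of_notMem hx, mul_zero]
    exact Finset.sum_eq_zero fun b _ => by rw [Set.indicator_of_notMem hx, mul_zero]

def sigmaPlus : Matrix (Fin 2) (Fin 2) ℂ := !![0, 0; 1, 0]

def sigmaMinus : Matrix (Fin 2) (Fin 2) ℂ := !![0, 1; 0, 0]

/-- The matrix of `I ⊗ … ⊗ I ⊗ s ⊗ I ⊗ … ⊗ I` (`n` factors, `s` at place `i`) in the basis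
`|ε₁ … εₙ⟩`. -/
def onQubit {n : ℕ} (s : Matrix (Fin 2) (Fin 2) ℂ) (i : Fin n) :
    Matrix (Fin n → Fin 2) (Fin n → Fin 2) ℂ :=
  Matrix.of fun a b => ∏ j, (if j = i then s else 1) (a j) (b j)

/-- The gate `s` on the qubit number `k + 1` (counted from `1`), acting on functions on `(0,1]`. -/
def gate (s : Matrix (Fin 2) (Fin 2) ℂ) (k : ℕ) (f : ℝ → ℂ) : ℝ → ℂ :=
  localAction (onQubit s (Fin.last k)) f

/-- The terms `2^{-k} s^k [f](x)`, `k = 1, 2, …`, shifted to start at `0`. -/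
def periodTerm (s : Matrix (Fin 2) (Fin 2) ℂ) (f : ℝ → ℂ) (x : ℝ) (k : ℕ) : ℂ :=
  (1 / 2 ^ (k + 1)) * gate s k f x

/-- The periodization `∑_{k ≥ 1} 2^{-k} s^k` of `s`, acting on functions on `(0,1]`. -/
def period (s : Matrix (Fin 2) (Fin 2) ℂ) (f : ℝ → ℂ) (x : ℝ) : ℂ := ∑' k, periodTerm s f x k

/-- The antiderivative. -/
def antideriv (f : ℝ → ℂ) (x : ℝ) : ℂ := ∫ y in (0 : ℝ)..x, f y

/-- The transpose of the antiderivative. -/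
def antiderivTr (f : ℝ → ℂ) (x : ℝ) : ℂ := ∫ y in x..(1 : ℝ), f y

/-- `P₋ = C₋ + L` on functions. -/
def Pminus (f : ℝ → ℂ) (x : ℝ) : ℂ := period sigmaMinus f x + antideriv f x

/-- `P₊ = C₊ + L'` on functions. -/
def Pplus (f : ℝ → ℂ) (x : ℝ) : ℂ := period sigmaPlus f x + antiderivTr f x

end

end HaarQubit

open HaarQubit

/-!
Everything here is determined by its behaviour on the two halves of `(0,1]`. Under the maps
`half i x = (x + i) / 2` the first qubit of `half i x` is `i` and the other qubits are those of `x`,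
shifted by one place; integration splits accordingly, and `H_{n+1,l}` is `√2 H_{n,k}` on one half
and `0` on the other. For `P = C + a L + b L'`, where `C` is the periodization of `a σ₋ + b σ₊`, and
for `j` the other half, this gives
`P f (half i x) = (u f (half j x) + v ∫ f ∘ half j + P (f ∘ half i) x) / 2`
with `(u, v) = (a, b)` for `i = 0` and `(u, v) = (b, a)` for `i = 1`.
The integral term vanishes on `H_{n,k}` for `n ≥ 1`, and what is left is the recurrence for the
blocks; on `H` the terms cancel. The blocks determine `P`, because the Haar functions are complete,
and taking conjugate transposes of the blocks exchanges `P₋` and `P₊`.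
-/

namespace HaarQubit

noncomputable section

/-! ### Halves of the unit interval and binary digits -/

/-- The affine bijection of `(0,1]` onto its first (`i = 0`) or second (`i = 1`) half. -/
def half (i : Fin 2) (x : ℝ) : ℝ := (x + (i : ℝ)) / 2

theorem continuous_half (i : Fin 2) : Continuous (half i) := by
  unfold half
  fun_prop

theorem measurable_half (i : Fin 2) : Measurable (half i) := (continuous_half i).measurable

theorem half_mem (i : Fin 2) {x : ℝ} (hx : x ∈ Ioc (0 : ℝ) 1) : half i x ∈ Ioc (0 : ℝ) 1 := by
  obtain ⟨h0, h1⟩ := hx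
  fin_cases i <;> simp only [half, mem_Ioc] <;> constructor <;> norm_num <;> linarith

theorem exists_half_eq {x : ℝ} (hx : x ∈ Ioc (0 : ℝ) 1) :
    ∃ i, ∃ y ∈ Ioc (0 : ℝ) 1, half i y = x := by
  rcases le_or_gt x (1 / 2) with h | h
  · exact ⟨0, 2 * x, ⟨by linarith [hx.1], by linarith⟩, by simp [half]⟩
  · exact ⟨1, 2 * x - 1, ⟨by linarith, by linarith [hx.2]⟩, by simp [half]⟩

/-- The state of the qubit number `k + 1` at `x`, that is, the parity of the number of the dyadic
interval of length `2⁻ᵏ⁻¹` of `x`. On `(0,1]` it is a binary digit of `x`, with the expansion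
ending in `111…` chosen where there are two. -/
def qubit (k : ℕ) (x : ℝ) : Fin 2 := if Odd ⌈2 ^ (k + 1) * x⌉ then 0 else 1

/-- The point obtained from `x` by giving the qubit number `k + 1` the state `j`. -/
def setQubit (k : ℕ) (j : Fin 2) (x : ℝ) : ℝ := x + ((j : ℝ) - (qubit k x : ℝ)) / 2 ^ (k + 1)

/-- The negation of the qubit number `k + 1`. -/
def flip (k : ℕ) (x : ℝ) : ℝ := setQubit k (qubit k x).rev x

theorem qubit_zero_half (i : Fin 2) {x : ℝ} (hx : x ∈ Ioc (0 : ℝ) 1) : qubit 0 (half i x) = i := by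
  have hceil : ⌈x⌉ = 1 := by
    rw [Int.ceil_eq_iff]
    simpa using hx
  fin_cases i <;> simp [qubit, half, mul_div_cancel₀, hceil]

theorem qubit_succ_half (k : ℕ) (i : Fin 2) (x : ℝ) : qubit (k + 1) (half i x) = qubit k x := by
  have h : (2 : ℝ) ^ (k + 1 + 1) * half i x = 2 ^ (k + 1) * x + ((2 * (2 ^ k * i) : ℤ) : ℝ) := by
    rw [half]
    push_cast
    ring
  have hodd : ¬ Odd (2 * (2 ^ k * i : ℤ)) := by simp
  unfold qubit
  rw [h, Int.ceil_add_intCast]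
  exact if_congr (by rw [Int.odd_add, iff_true_right (Int.not_odd_iff_even.mp hodd)]) rfl rfl

theorem setQubit_zero_half (i j : Fin 2) {x : ℝ} (hx : x ∈ Ioc (0 : ℝ) 1) :
    setQubit 0 j (half i x) = half j x := by
  rw [setQubit, qubit_zero_half i hx, half, half]
  ring

theorem setQubit_succ_half (k : ℕ) (i j : Fin 2) (x : ℝ) :
    setQubit (k + 1) j (half i x) = half i (setQubit k j x) := by
  rw [setQubit, setQubit, qubit_succ_half, half, half]
  ring

theorem setQubit_mem (k : ℕ) (j : Fin 2) {x : ℝ} (hx : x ∈ Ioc (0 : ℝ) 1) :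
    setQubit k j x ∈ Ioc (0 : ℝ) 1 := by
  induction k generalizing x with
  | zero =>
    obtain ⟨i, y, hy, rfl⟩ := exists_half_eq hx
    rw [setQubit_zero_half i j hy]
    exact half_mem j hy
  | succ k ih =>
    obtain ⟨i, y, hy, rfl⟩ := exists_half_eq hx
    rw [setQubit_succ_half]
    exact half_mem i (ih hy)

theorem flip_zero_half (i : Fin 2) {x : ℝ} (hx : x ∈ Ioc (0 : ℝ) 1) :
    flip 0 (half i x) = half i.rev x := by
  rw [flip, qubit_zero_half i hx, setQubit_zero_half i _ hx]

theorem flip_succ_half (k : ℕ) (i : Fin 2) (x : ℝ) :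
    flip (k + 1) (half i x) = half i (flip k x) := by
  rw [flip, flip, qubit_succ_half, setQubit_succ_half]

theorem measurable_qubit (k : ℕ) : Measurable (qubit k) := by
  have hceil : Measurable fun x : ℝ => ⌈2 ^ (k + 1) * x⌉ := Int.measurable_ceil.comp (by fun_prop)
  exact (Measurable.of_discrete (f := fun m : ℤ => if Odd m then (0 : Fin 2) else 1)).comp hceil

theorem measurable_flip (k : ℕ) : Measurable (flip k) := by
  have h : Measurable fun i : Fin 2 => ((i.rev : ℝ) - (i : ℝ)) / 2 ^ (k + 1) := .of_discrete
  exact measurable_id.add (h.comp (measurable_qubit k))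

/-! ### The action of a gate -/

theorem mem_dyadic_iff {n m : ℕ} {x : ℝ} : x ∈ dyadic n m ↔ ⌈2 ^ n * x⌉ = (m : ℤ) + 1 := by
  have hp : (0 : ℝ) < 2 ^ n := by positivity
  rw [Int.ceil_eq_iff, dyadic, mem_Ioc, div_lt_iff₀' hp, le_div_iff₀' hp]
  push_cast
  rw [add_sub_cancel_right]

theorem bitIndex_snoc {k : ℕ} (e : Fin k → Fin 2) (i : Fin 2) :
    bitIndex (Fin.snoc e i : Fin (k + 1) → Fin 2) = 2 * bitIndex e + i := by
  simp only [bitIndex, Fin.sum_univ_castSucc, Fin.snoc_castSucc, Fin.snoc_last, Fin.rev_last,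
    Fin.rev_castSucc, Fin.val_succ, Fin.val_zero, pow_zero, mul_one, Finset.mul_sum, pow_succ,
    mul_comm, mul_left_comm]

theorem qubit_of_mem_dyadic {k : ℕ} {e : Fin k → Fin 2} {i : Fin 2} {x : ℝ}
    (hx : x ∈ dyadic (k + 1) (bitIndex (Fin.snoc e i : Fin (k + 1) → Fin 2))) :
    qubit k x = i := by
  rw [mem_dyadic_iff, bitIndex_snoc] at hx
  rw [qubit, hx]
  fin_cases i <;> simp [parity_simps]

theorem exists_mem_dyadic_bitIndex (n : ℕ) {x : ℝ} (hx : x ∈ Ioc (0 : ℝ) 1) :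
    ∃ e : Fin n → Fin 2, x ∈ dyadic n (bitIndex e) := by
  induction n with
  | zero => exact ⟨0, by simpa [dyadic, bitIndex] using hx⟩
  | succ n ih =>
    obtain ⟨e, hlt, hle⟩ := ih
    rw [div_lt_iff₀' (by positivity)] at hlt
    rw [le_div_iff₀' (by positivity)] at hle
    have hmem : ∀ i : Fin 2, x ∈ dyadic (n + 1) (bitIndex (Fin.snoc e i : Fin (n + 1) → Fin 2)) ↔
        2 * (bitIndex e : ℝ) + i < 2 * (2 ^ n * x) ∧
          2 * (2 ^ n * x) ≤ 2 * (bitIndex e : ℝ) + i + 1 := fun i => by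
      rw [dyadic, mem_Ioc, div_lt_iff₀' (by positivity), le_div_iff₀' (by positivity),
        bitIndex_snoc, pow_succ', mul_assoc]
      push_cast
      rfl
    rcases le_or_gt (2 * (2 ^ n * x)) (2 * (bitIndex e : ℝ) + 1) with h | h
    · exact ⟨Fin.snoc e 0, (hmem 0).mpr (by norm_num; constructor <;> linarith)⟩
    · exact ⟨Fin.snoc e 1, (hmem 1).mpr (by norm_num; constructor <;> linarith)⟩

theorem localAction_of_mem_dyadic {n : ℕ} (U : Matrix (Fin n → Fin 2) (Fin n → Fin 2) ℂ)
    (f : ℝ → ℂ) {a : Fin n → Fin 2} {x : ℝ} (hx : x ∈ dyadic n (bitIndex a)) :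
    localAction U f x = ∑ b, U a b * f (x + ((bitIndex b : ℝ) - bitIndex a) / 2 ^ n) := by
  unfold localAction
  rw [Finset.sum_eq_single a]
  · simp only [indicator_of_mem hx]
  · intro c _ hca
    have hxc : x ∉ dyadic n (bitIndex c) := fun hxc => hca <| bitIndex_injective n <| by
      rw [mem_dyadic_iff] at hx hxc
      omega
    simp only [indicator_of_notMem hxc, mul_zero, Finset.sum_const_zero]
  · simp

theorem onQubit_last_snoc {k : ℕ} (s : Matrix (Fin 2) (Fin 2) ℂ) (e e' : Fin k → Fin 2)
    (i j : Fin 2) :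
    onQubit s (Fin.last k) (Fin.snoc e i) (Fin.snoc e' j) = if e = e' then s i j else 0 := by
  simp only [onQubit, Matrix.of_apply]
  rw [Fin.prod_univ_castSucc]
  simp only [Fin.snoc_castSucc, Fin.snoc_last, if_true, (Fin.castSucc_lt_last _).ne, if_false]
  split_ifs with h
  · subst h
    rw [Finset.prod_eq_one fun l _ => Matrix.one_apply_eq (e l), one_mul]
  · obtain ⟨l, hl⟩ := Function.ne_iff.mp h
    have hl0 : (1 : Matrix (Fin 2) (Fin 2) ℂ) (e l) (e' l) = 0 := Matrix.one_apply_ne hl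
    exact mul_eq_zero_of_left (Finset.prod_eq_zero (Finset.mem_univ l) hl0) _

theorem gate_eq_sum (s : Matrix (Fin 2) (Fin 2) ℂ) (k : ℕ) (f : ℝ → ℂ) {x : ℝ}
    (hx : x ∈ Ioc (0 : ℝ) 1) : gate s k f x = ∑ j, s (qubit k x) j * f (setQubit k j x) := by
  obtain ⟨a, ha⟩ := exists_mem_dyadic_bitIndex (k + 1) hx
  obtain ⟨⟨i, e⟩, rfl⟩ := (Fin.snocEquiv fun _ : Fin (k + 1) => Fin 2).surjective a
  change x ∈ dyadic (k + 1) (bitIndex (Fin.snoc e i : Fin (k + 1) → Fin 2)) at ha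
  rw [gate, localAction_of_mem_dyadic _ f ha,
    ← (Fin.snocEquiv fun _ : Fin (k + 1) => Fin 2).sum_comp, Fintype.sum_prod_type,
    qubit_of_mem_dyadic ha]
  refine Finset.sum_congr rfl fun j _ => ?_
  rw [Finset.sum_eq_single e]
  · change onQubit s (Fin.last k) (Fin.snoc e i) (Fin.snoc e j) *
      f (x + (((bitIndex (Fin.snoc e j : Fin (k + 1) → Fin 2) : ℕ) : ℝ) - _) / _) = _
    rw [onQubit_last_snoc, if_pos rfl, setQubit, qubit_of_mem_dyadic ha, bitIndex_snoc,
      bitIndex_snoc]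
    push_cast
    rw [add_sub_add_left_eq_sub]
  · intro e' _ he'
    change onQubit s (Fin.last k) (Fin.snoc e i) (Fin.snoc e' j) * _ = 0
    rw [onQubit_last_snoc, if_neg he'.symm, zero_mul]
  · simp

theorem gate_eq_add_flip (s : Matrix (Fin 2) (Fin 2) ℂ) (k : ℕ) (f : ℝ → ℂ) {x : ℝ}
    (hx : x ∈ Ioc (0 : ℝ) 1) :
    gate s k f x = s (qubit k x) (qubit k x) * f x +
      s (qubit k x) (qubit k x).rev * f (flip k x) := by
  have hself : setQubit k (qubit k x) x = x := by simp [setQubit]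
  have hsum : ∀ (F : Fin 2 → ℂ) (i : Fin 2), ∑ j, F j = F i + F i.rev := fun F i => by
    fin_cases i
    · exact Fin.sum_univ_two F
    · exact (Fin.sum_univ_two F).trans (add_comm _ _)
  rw [gate_eq_sum s k f hx, hsum _ (qubit k x), hself, flip]

/-! ### Lebesgue measure as a self-similar measure -/

instance : IsProbabilityMeasure mu := ⟨by simp⟩

theorem half_preimage_Ioc (i : Fin 2) :
    half i ⁻¹' Ioc ((i : ℝ) / 2) ((i + 1 : ℝ) / 2) = Ioc 0 1 := by
  ext x
  simp only [half, mem_preimage, mem_Ioc]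
  constructor <;> rintro ⟨h0, h1⟩ <;> constructor <;> linarith

theorem map_half_mu (i : Fin 2) :
    mu.map (half i) = (2 : ENNReal) • volume.restrict (Ioc ((i : ℝ) / 2) ((i + 1 : ℝ) / 2)) := by
  have hcomp : half i = (2⁻¹ * ·) ∘ (· + (i : ℝ)) := by
    funext x
    simp only [half, Function.comp_apply]
    ring
  have hvol : (volume : Measure ℝ).map (half i) = (2 : ENNReal) • volume := by
    rw [hcomp, ← Measure.map_map (by fun_prop) (by fun_prop), map_add_right_eq_self,
      Real.map_volume_mul_left (by norm_num)]
    norm_num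
  rw [← Measure.restrict_smul, ← hvol, Measure.restrict_map (measurable_half i) measurableSet_Ioc,
    half_preimage_Ioc]

theorem mu_eq_map_half : mu = (2⁻¹ : ENNReal) • (mu.map (half 0) + mu.map (half 1)) := by
  have hunion : Ioc (0 : ℝ) 2⁻¹ ∪ Ioc (2⁻¹ : ℝ) 1 = Ioc 0 1 :=
    Ioc_union_Ioc_eq_Ioc (by norm_num) (by norm_num)
  have h := Measure.restrict_union (μ := (volume : Measure ℝ))
    (Ioc_disjoint_Ioc_of_le (le_refl (2⁻¹ : ℝ))) (measurableSet_Ioc (a := (2⁻¹ : ℝ)) (b := 1))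
    (s := Ioc 0 2⁻¹)
  rw [hunion] at h
  rw [map_half_mu, map_half_mu, ← smul_add, smul_smul, ENNReal.inv_mul_cancel (by simp) (by simp),
    one_smul]
  norm_num [h]

theorem integrable_comp_half {f : ℝ → ℂ} (hf : Integrable f mu) (i : Fin 2) :
    Integrable (f ∘ half i) mu := by
  rw [mu_eq_map_half, integrable_smul_measure (by simp) (by simp), integrable_add_measure] at hf
  fin_cases i
  · exact hf.1.comp_measurable (measurable_half 0)
  · exact hf.2.comp_measurable (measurable_half 1)

theorem integral_eq_integral_comp_half {f : ℝ → ℂ} (hf : Integrable f mu) :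
    ∫ x, f x ∂mu = ((∫ x, f (half 0 x) ∂mu) + ∫ x, f (half 1 x) ∂mu) / 2 := by
  have hmap := hf
  rw [mu_eq_map_half, integrable_smul_measure (by simp) (by simp), integrable_add_measure] at hmap
  conv_lhs => rw [mu_eq_map_half]
  rw [integral_smul_measure, integral_add_measure hmap.1 hmap.2,
    integral_map (measurable_half 0).aemeasurable hmap.1.aestronglyMeasurable,
    integral_map (measurable_half 1).aemeasurable hmap.2.aestronglyMeasurable, Complex.real_smul]
  norm_num
  ring

theorem map_flip_mu (k : ℕ) : mu.map (flip k) = mu := by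
  have hsplit : mu.map (flip k) =
      (2⁻¹ : ENNReal) • (mu.map (flip k ∘ half 0) + mu.map (flip k ∘ half 1)) := by
    conv_lhs => rw [mu_eq_map_half]
    rw [Measure.map_smul, Measure.map_add _ _ (measurable_flip k),
      Measure.map_map (measurable_flip k) (measurable_half 0),
      Measure.map_map (measurable_flip k) (measurable_half 1)]
  conv_rhs => rw [mu_eq_map_half]
  rw [hsplit]
  cases k with
  | zero =>
    have hswap (i : Fin 2) : mu.map (flip 0 ∘ half i) = mu.map (half i.rev) :=
      Measure.map_congr <| (ae_restrict_iff' measurableSet_Ioc).mpr <| .of_forall fun _ hx =>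
        flip_zero_half i hx
    rw [hswap, hswap, add_comm]
    rfl
  | succ k =>
    have hcomm (i : Fin 2) : mu.map (flip (k + 1) ∘ half i) = mu.map (half i) := by
      rw [show flip (k + 1) ∘ half i = half i ∘ flip k from funext (flip_succ_half k i),
        ← Measure.map_map (measurable_half i) (measurable_flip k), map_flip_mu k]
    rw [hcomm, hcomm]

theorem measurePreserving_flip (k : ℕ) : MeasurePreserving (flip k) mu mu :=
  ⟨measurable_flip k, map_flip_mu k⟩

/-! ### Bounded operators given by formulas -/

section Operators

variable {α 𝕜 E : Type*} [MeasurableSpace α] {μ : Measure α} [NontriviallyNormedField 𝕜]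
  [NormedAddCommGroup E] [NormedSpace 𝕜 E] {p : ENNReal} [Fact (1 ≤ p)]

theorem exists_continuousLinearMap_of_eLpNorm_le {op : (α → E) → α → E} {C : NNReal}
    (hadd : ∀ f g, MemLp f p μ → MemLp g p μ → op (f + g) =ᵐ[μ] op f + op g)
    (hsmul : ∀ (c : 𝕜) f, MemLp f p μ → op (c • f) =ᵐ[μ] c • op f)
    (hmeas : ∀ f, MemLp f p μ → AEStronglyMeasurable (op f) μ)
    (hbound : ∀ f, MemLp f p μ → eLpNorm (op f) p μ ≤ C * eLpNorm f p μ) :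
    ∃ A : Lp E p μ →L[𝕜] Lp E p μ, ‖A‖ ≤ C ∧
      ∀ (f : α → E) (hf : MemLp f p μ), A hf.toLp =ᵐ[μ] op f := by
  have hp : p ≠ 0 := (zero_lt_one.trans_le Fact.out).ne'
  have hmem : ∀ f, MemLp f p μ → MemLp (op f) p μ := fun f hf =>
    ⟨hmeas f hf, (hbound f hf).trans_lt (ENNReal.mul_lt_top ENNReal.coe_lt_top hf.2)⟩
  have hcongr : ∀ f g, MemLp f p μ → MemLp g p μ → f =ᵐ[μ] g → op f =ᵐ[μ] op g := by
    intro f g hf hg hfg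
    have hzero : op (f - g) =ᵐ[μ] 0 := by
      rw [← eLpNorm_eq_zero_iff (hmeas _ (hf.sub hg)) hp, ← nonpos_iff_eq_zero]
      refine (hbound _ (hf.sub hg)).trans_eq ?_
      rw [eLpNorm_congr_ae (hfg.sub (.refl _ g)), sub_self, eLpNorm_zero, mul_zero]
    have hsplit := hadd g (f - g) hg (hf.sub hg)
    rw [add_sub_cancel] at hsplit
    filter_upwards [hzero, hsplit] with x hx0 hx1
    rw [hx1, Pi.add_apply, hx0, Pi.zero_apply, add_zero]
  let A : Lp E p μ →ₗ[𝕜] Lp E p μ :=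
    { toFun := fun f => (hmem f (Lp.memLp f)).toLp
      map_add' := fun f g => by
        rw [← MemLp.toLp_add, MemLp.toLp_eq_toLp_iff]
        exact (hcongr _ _ (Lp.memLp _) ((Lp.memLp f).add (Lp.memLp g)) (Lp.coeFn_add f g)).trans
          (hadd _ _ (Lp.memLp f) (Lp.memLp g))
      map_smul' := fun c f => by
        rw [RingHom.id_apply, ← MemLp.toLp_const_smul, MemLp.toLp_eq_toLp_iff]
        exact (hcongr _ _ (Lp.memLp _) ((Lp.memLp f).const_smul c) (Lp.coeFn_smul c f)).trans
          (hsmul c _ (Lp.memLp f)) }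
  have hA : ∀ f, ‖A f‖ ≤ C * ‖f‖ := fun f => by
    change ‖(hmem f (Lp.memLp f)).toLp‖ ≤ _
    rw [Lp.norm_toLp, Lp.norm_def, ← ENNReal.coe_toReal, ← ENNReal.toReal_mul]
    exact ENNReal.toReal_mono (ENNReal.mul_ne_top ENNReal.coe_ne_top (Lp.memLp f).2.ne)
      (hbound f (Lp.memLp f))
  refine ⟨A.mkContinuous C hA, A.mkContinuous_norm_le C.2 hA, fun f hf => ?_⟩
  exact (hmem _ (Lp.memLp hf.toLp)).coeFn_toLp.trans (hcongr _ _ (Lp.memLp _) hf hf.coeFn_toLp)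

theorem exists_continuousLinearMap_smul_comp {w : α → 𝕜} (hw : AEStronglyMeasurable w μ)
    {C : NNReal} (hC : ∀ x, ‖w x‖ ≤ C) {τ : α → α} (hτ : MeasurePreserving τ μ μ) :
    ∃ A : Lp E p μ →L[𝕜] Lp E p μ, ‖A‖ ≤ C ∧
      ∀ (f : α → E) (hf : MemLp f p μ), A hf.toLp =ᵐ[μ] fun x => w x • f (τ x) :=
  exists_continuousLinearMap_of_eLpNorm_le
    (fun f g _ _ => .of_forall fun x => smul_add (w x) (f (τ x)) (g (τ x)))
    (fun c f _ => .of_forall fun x => smul_comm (w x) c (f (τ x)))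
    (fun f hf => hw.smul (hf.1.comp_measurePreserving hτ))
    (fun f hf => by
      rw [← eLpNorm_comp_measurePreserving hf.1 hτ]
      refine eLpNorm_le_nnreal_smul_eLpNorm_of_ae_le_mul (.of_forall fun x => ?_) p
      rw [← NNReal.coe_le_coe, NNReal.coe_mul, coe_nnnorm, coe_nnnorm, norm_smul]
      exact mul_le_mul_of_nonneg_right (hC x) (norm_nonneg _))

theorem exists_continuousLinearMap_of_norm_le_integral [IsProbabilityMeasure μ]
    {op : (α → E) → α → E}
    (hadd : ∀ f g, Integrable f μ → Integrable g μ → op (f + g) =ᵐ[μ] op f + op g)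
    (hsmul : ∀ (c : 𝕜) f, Integrable f μ → op (c • f) =ᵐ[μ] c • op f)
    (hmeas : ∀ f, Integrable f μ → AEStronglyMeasurable (op f) μ)
    (hbound : ∀ f, Integrable f μ → ∀ᵐ x ∂μ, ‖op f x‖ ≤ ∫ y, ‖f y‖ ∂μ) :
    ∃ A : Lp E p μ →L[𝕜] Lp E p μ,
      ∀ (f : α → E) (hf : MemLp f p μ), A hf.toLp =ᵐ[μ] op f := by
  have hp : 1 ≤ p := Fact.out
  obtain ⟨A, -, hA⟩ := exists_continuousLinearMap_of_eLpNorm_le (C := 1) (p := p)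
    (fun f g hf hg => hadd f g (hf.integrable hp) (hg.integrable hp))
    (fun c f hf => hsmul c f (hf.integrable hp)) (fun f hf => hmeas f (hf.integrable hp))
    (fun f hf => by
      refine (eLpNorm_le_of_ae_bound (hbound f (hf.integrable hp))).trans ?_
      rw [measure_univ, ENNReal.one_rpow, one_mul, ENNReal.coe_one, one_mul,
        ofReal_integral_norm_eq_lintegral_enorm (hf.integrable hp),
        ← eLpNorm_one_eq_lintegral_enorm]
      exact eLpNorm_le_eLpNorm_of_exponent_le hp hf.1)
  exact ⟨A, hA⟩

theorem ae_hasSum_tsum_apply [CompleteSpace E] {A : ℕ → Lp E p μ →L[𝕜] Lp E p μ}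
    (hA : Summable fun k => ‖A k‖) (f : Lp E p μ) :
    ∀ᵐ x ∂μ, HasSum (fun k => (A k f : α → E) x) (((∑' k, A k) f : Lp E p μ) x) := by
  have happ : HasSum (fun k => A k f) ((∑' k, A k) f) :=
    (ContinuousLinearMap.apply 𝕜 _ f).hasSum hA.of_norm.hasSum
  have hfin : ∑' k, ‖A k f‖ₑ ≠ ⊤ := by
    rw [tsum_enorm_ne_top_iff_summable_norm]
    exact .of_nonneg_of_le (fun _ => norm_nonneg _) (fun k => (A k).le_opNorm f) (hA.mul_right ‖f‖)
  rw [← happ.tsum_eq]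
  exact Lp.hasSum_coeFn_tsum hfin

end Operators

/-! ### Periodization and integration are bounded -/

theorem exists_continuousLinearMap_gate (s : Matrix (Fin 2) (Fin 2) ℂ) :
    ∃ C, ∀ k, ∃ A : L2 →L[ℂ] L2, ‖A‖ ≤ C ∧
      ∀ (f : ℝ → ℂ) (hf : MemLp f 2 mu), A hf.toLp =ᵐ[mu] gate s k f := by
  set C : NNReal := ∑ i, ∑ j, ‖s i j‖₊
  have hC : ∀ i j, ‖s i j‖ ≤ C := fun i j => by
    have hi := Finset.single_le_sum (f := fun i => ∑ j, ‖s i j‖₊) (fun _ _ => zero_le)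
      (Finset.mem_univ i)
    exact (Finset.single_le_sum (f := fun j => ‖s i j‖₊) (fun _ _ => zero_le)
      (Finset.mem_univ j)).trans hi
  refine ⟨C + C, fun k => ?_⟩
  have hw : ∀ r : Fin 2 → Fin 2,
      AEStronglyMeasurable (fun x => s (qubit k x) (r (qubit k x))) mu := fun r =>
    ((Measurable.of_discrete (f := fun i => s i (r i))).comp
      (measurable_qubit k)).aestronglyMeasurable
  obtain ⟨A, hA, hAf⟩ := exists_continuousLinearMap_smul_comp (E := ℂ) (p := 2) (hw id)
    (fun _ => hC _ _) (.id mu)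
  obtain ⟨B, hB, hBf⟩ := exists_continuousLinearMap_smul_comp (E := ℂ) (p := 2) (hw Fin.rev)
    (fun _ => hC _ _) (measurePreserving_flip k)
  refine ⟨A + B, norm_add_le_of_le hA hB, fun f hf => ?_⟩
  filter_upwards [ae_restrict_mem measurableSet_Ioc, hAf f hf, hBf f hf,
    Lp.coeFn_add (A hf.toLp) (B hf.toLp)] with x hx hAx hBx hadd
  rw [add_apply, hadd, Pi.add_apply, hAx, hBx, gate_eq_add_flip s k f hx]
  rfl

theorem exists_continuousLinearMap_period (s : Matrix (Fin 2) (Fin 2) ℂ) :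
    ∃ A : L2 →L[ℂ] L2, ∀ (f : ℝ → ℂ) (hf : MemLp f 2 mu),
      ∀ᵐ x ∂mu, HasSum (periodTerm s f x) ((A hf.toLp : ℝ → ℂ) x) := by
  obtain ⟨C, hC⟩ := exists_continuousLinearMap_gate s
  choose E hE hEf using hC
  have hsum : Summable fun k => ‖(1 / 2 ^ (k + 1) : ℂ) • E k‖ := by
    refine .of_nonneg_of_le (fun _ => norm_nonneg _) (fun k => ?_)
      (((summable_nat_add_iff 1).mpr summable_geometric_two).mul_right C)
    rw [norm_smul, ← one_div_pow, norm_pow, norm_div, norm_one, Complex.norm_ofNat]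
    exact mul_le_mul_of_nonneg_left (hE k) (by positivity)
  refine ⟨∑' k, (1 / 2 ^ (k + 1) : ℂ) • E k, fun f hf => ?_⟩
  have hterm : ∀ᵐ x ∂mu, ∀ k,
      (((1 / 2 ^ (k + 1) : ℂ) • E k) hf.toLp : L2) x = periodTerm s f x k := by
    rw [ae_all_iff]
    intro k
    filter_upwards [Lp.coeFn_smul (1 / 2 ^ (k + 1) : ℂ) (E k hf.toLp), hEf k f hf] with x hsmul hx
    rw [smul_apply, hsmul, Pi.smul_apply, hx, smul_eq_mul, periodTerm]
  filter_upwards [ae_hasSum_tsum_apply hsum hf.toLp, hterm] with x hx hterm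
  simpa only [hterm] using hx

theorem intervalIntegrable_of_integrable_mu {f : ℝ → ℂ} (hf : Integrable f mu) {x y : ℝ}
    (hx : x ∈ Icc (0 : ℝ) 1) (hy : y ∈ Icc (0 : ℝ) 1) : IntervalIntegrable f volume x y := by
  have h : IntervalIntegrable f volume 0 1 :=
    (intervalIntegrable_iff_integrableOn_Ioc_of_le zero_le_one).mpr hf
  exact h.mono_set (by rw [uIcc_of_le zero_le_one]; exact uIcc_subset_Icc hx hy)

theorem continuousOn_antideriv {f : ℝ → ℂ} (hf : Integrable f mu) :
    ContinuousOn (antideriv f) (Icc 0 1) := by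
  have h := intervalIntegral.continuousOn_primitive_interval' (μ := volume)
    (intervalIntegrable_of_integrable_mu hf (left_mem_Icc.mpr zero_le_one)
      (right_mem_Icc.mpr zero_le_one)) left_mem_uIcc
  rwa [uIcc_of_le zero_le_one] at h

theorem antideriv_add_antiderivTr {f : ℝ → ℂ} (hf : Integrable f mu) {x : ℝ}
    (hx : x ∈ Icc (0 : ℝ) 1) : antideriv f x + antiderivTr f x = ∫ y, f y ∂mu := by
  rw [antideriv, antiderivTr, intervalIntegral.integral_add_adjacent_intervals,
    intervalIntegral.integral_of_le zero_le_one]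
  · exact intervalIntegrable_of_integrable_mu hf (left_mem_Icc.mpr zero_le_one) hx
  · exact intervalIntegrable_of_integrable_mu hf hx (right_mem_Icc.mpr zero_le_one)

theorem continuousOn_antiderivTr {f : ℝ → ℂ} (hf : Integrable f mu) :
    ContinuousOn (antiderivTr f) (Icc 0 1) :=
  (continuousOn_const.sub (continuousOn_antideriv hf)).congr fun _ hx =>
    eq_sub_of_add_eq' (antideriv_add_antiderivTr hf hx)

theorem norm_intervalIntegral_le {f : ℝ → ℂ} (hf : Integrable f mu) {x y : ℝ}
    (hx : x ∈ Icc (0 : ℝ) 1) (hy : y ∈ Icc (0 : ℝ) 1) :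
    ‖∫ t in x..y, f t‖ ≤ ∫ t, ‖f t‖ ∂mu :=
  intervalIntegral.norm_integral_le_integral_norm_uIoc.trans <|
    setIntegral_mono_set hf.norm (.of_forall fun _ => norm_nonneg _)
      (Ioc_subset_Ioc (le_min hx.1 hy.1) (max_le hx.2 hy.2)).eventuallyLE

theorem exists_continuousLinearMap_antideriv :
    ∃ A : L2 →L[ℂ] L2, ∀ (f : ℝ → ℂ) (hf : MemLp f 2 mu), A hf.toLp =ᵐ[mu] antideriv f := by
  have h0 : (0 : ℝ) ∈ Icc (0 : ℝ) 1 := left_mem_Icc.mpr zero_le_one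
  obtain ⟨A, hA⟩ := exists_continuousLinearMap_of_norm_le_integral (𝕜 := ℂ) (p := 2) (μ := mu)
    (op := antideriv)
    (fun f g hf hg => (ae_restrict_mem measurableSet_Ioc).mono fun x hx =>
      intervalIntegral.integral_add
        (intervalIntegrable_of_integrable_mu hf h0 (Ioc_subset_Icc_self hx))
        (intervalIntegrable_of_integrable_mu hg h0 (Ioc_subset_Icc_self hx)))
    (fun c f _ => .of_forall fun _ => intervalIntegral.integral_smul c f)
    (fun f hf => ((continuousOn_antideriv hf).mono
      Ioc_subset_Icc_self).aestronglyMeasurable measurableSet_Ioc)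
    (fun f hf => (ae_restrict_mem measurableSet_Ioc).mono fun x hx =>
      norm_intervalIntegral_le hf h0 (Ioc_subset_Icc_self hx))
  exact ⟨A, hA⟩

theorem exists_continuousLinearMap_antiderivTr :
    ∃ A : L2 →L[ℂ] L2, ∀ (f : ℝ → ℂ) (hf : MemLp f 2 mu), A hf.toLp =ᵐ[mu] antiderivTr f := by
  have h1 : (1 : ℝ) ∈ Icc (0 : ℝ) 1 := right_mem_Icc.mpr zero_le_one
  obtain ⟨A, hA⟩ := exists_continuousLinearMap_of_norm_le_integral (𝕜 := ℂ) (p := 2) (μ := mu)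
    (op := antiderivTr)
    (fun f g hf hg => (ae_restrict_mem measurableSet_Ioc).mono fun x hx =>
      intervalIntegral.integral_add
        (intervalIntegrable_of_integrable_mu hf (Ioc_subset_Icc_self hx) h1)
        (intervalIntegrable_of_integrable_mu hg (Ioc_subset_Icc_self hx) h1))
    (fun c f _ => .of_forall fun _ => intervalIntegral.integral_smul c f)
    (fun f hf => ((continuousOn_antiderivTr hf).mono
      Ioc_subset_Icc_self).aestronglyMeasurable measurableSet_Ioc)
    (fun f hf => (ae_restrict_mem measurableSet_Ioc).mono fun x hx =>
      norm_intervalIntegral_le hf (Ioc_subset_Icc_self hx) h1)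
  exact ⟨A, hA⟩

/-! ### Self-similarity of periodization and integration -/

theorem gate_zero_half (s : Matrix (Fin 2) (Fin 2) ℂ) (f : ℝ → ℂ) (i : Fin 2) {x : ℝ}
    (hx : x ∈ Ioc (0 : ℝ) 1) : gate s 0 f (half i x) = ∑ j, s i j * f (half j x) := by
  rw [gate_eq_sum s 0 f (half_mem i hx), qubit_zero_half i hx]
  simp only [setQubit_zero_half i _ hx]

theorem gate_succ_half (s : Matrix (Fin 2) (Fin 2) ℂ) (k : ℕ) (f : ℝ → ℂ) (i : Fin 2) {x : ℝ}
    (hx : x ∈ Ioc (0 : ℝ) 1) : gate s (k + 1) f (half i x) = gate s k (f ∘ half i) x := by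
  rw [gate_eq_sum s (k + 1) f (half_mem i hx), gate_eq_sum s k _ hx, qubit_succ_half]
  simp only [setQubit_succ_half, Function.comp_apply]

theorem periodTerm_succ_half (s : Matrix (Fin 2) (Fin 2) ℂ) (f : ℝ → ℂ) (i : Fin 2) {x : ℝ}
    (hx : x ∈ Ioc (0 : ℝ) 1) (k : ℕ) :
    periodTerm s f (half i x) (k + 1) = periodTerm s (f ∘ half i) x k / 2 := by
  rw [periodTerm, periodTerm, gate_succ_half s k f i hx]
  ring

theorem period_half (s : Matrix (Fin 2) (Fin 2) ℂ) {f : ℝ → ℂ} (i : Fin 2) {x : ℝ}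
    (hx : x ∈ Ioc (0 : ℝ) 1) (hf : Summable (periodTerm s f (half i x))) :
    period s f (half i x) = ((∑ j, s i j * f (half j x)) + period s (f ∘ half i) x) / 2 := by
  rw [period, hf.tsum_eq_zero_add, tsum_congr (periodTerm_succ_half s f i hx), tsum_div_const,
    periodTerm, gate_zero_half s f i hx, period]
  ring

theorem exists_norm_periodTerm_le (s : Matrix (Fin 2) (Fin 2) ℂ) {f : ℝ → ℂ} {M : ℝ}
    (hf : ∀ x, ‖f x‖ ≤ M) :
    ∃ C, ∀ x ∈ Ioc (0 : ℝ) 1, ∀ k, ‖periodTerm s f x k‖ ≤ C * (1 / 2) ^ (k + 1) := by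
  refine ⟨∑ i, ∑ j, ‖s i j‖ * M, fun x hx k => ?_⟩
  have hM : 0 ≤ M := (norm_nonneg _).trans (hf x)
  have hgate : ‖gate s k f x‖ ≤ ∑ i, ∑ j, ‖s i j‖ * M := by
    rw [gate_eq_sum s k f hx]
    refine (norm_sum_le_of_le _ fun j _ => ?_).trans
      (Finset.single_le_sum (f := fun i => ∑ j, ‖s i j‖ * M) (fun _ _ => by positivity)
        (Finset.mem_univ (qubit k x)))
    rw [norm_mul]
    exact mul_le_mul_of_nonneg_left (hf _) (norm_nonneg _)
  rw [periodTerm, norm_mul, mul_comm, ← one_div_pow, norm_pow, norm_div, norm_one,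
    Complex.norm_ofNat]
  exact mul_le_mul_of_nonneg_right hgate (by positivity)

theorem summable_periodTerm (s : Matrix (Fin 2) (Fin 2) ℂ) {f : ℝ → ℂ} {M : ℝ}
    (hf : ∀ x, ‖f x‖ ≤ M) {x : ℝ} (hx : x ∈ Ioc (0 : ℝ) 1) : Summable (periodTerm s f x) := by
  obtain ⟨C, hC⟩ := exists_norm_periodTerm_le s hf
  exact .of_norm_bounded (((summable_nat_add_iff 1).mpr summable_geometric_two).mul_left C)
    (hC x hx)

theorem exists_norm_period_le (s : Matrix (Fin 2) (Fin 2) ℂ) {f : ℝ → ℂ} {M : ℝ}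
    (hf : ∀ x, ‖f x‖ ≤ M) : ∃ C, ∀ x ∈ Ioc (0 : ℝ) 1, ‖period s f x‖ ≤ C := by
  obtain ⟨C, hC⟩ := exists_norm_periodTerm_le s hf
  exact ⟨_, fun x hx => tsum_of_norm_bounded
    (((summable_nat_add_iff 1).mpr summable_geometric_two).mul_left C).hasSum (hC x hx)⟩

theorem integral_half (f : ℝ → ℂ) (i : Fin 2) (x y : ℝ) :
    ∫ t in half i x..half i y, f t = (∫ t in x..y, f (half i t)) / 2 := by
  have h := intervalIntegral.smul_integral_comp_mul_add f (a := x) (b := y) (2⁻¹ : ℝ) (i / 2 : ℝ)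
  have hhalf : ∀ t, half i t = 2⁻¹ * t + i / 2 := fun t => by rw [half]; ring
  simp only [hhalf]
  rw [← h, Complex.real_smul]
  push_cast
  ring

theorem integral_mu (f : ℝ → ℂ) : ∫ x, f x ∂mu = ∫ x in (0 : ℝ)..1, f x :=
  (intervalIntegral.integral_of_le zero_le_one).symm

theorem antideriv_half {f : ℝ → ℂ} (hf : Integrable f mu) (i : Fin 2) {x : ℝ}
    (hx : x ∈ Ioc (0 : ℝ) 1) : antideriv f (half i x) =
      (![0, 1] i * (∫ y, f (half i.rev y) ∂mu) + antideriv (f ∘ half i) x) / 2 := by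
  have h00 : half 0 0 = 0 := by simp [half]
  have h01 : half 0 1 = half 1 0 := by simp [half]
  fin_cases i
  · have h := integral_half f 0 0 x
    rw [h00] at h
    simpa [antideriv] using h
  · have hsplit : antideriv f (half 1 x) =
        (∫ y in half 0 0..half 0 1, f y) + ∫ y in half 1 0..half 1 x, f y := by
      rw [← h01, h00]
      have hmid : half 0 1 ∈ Icc (0 : ℝ) 1 := Ioc_subset_Icc_self (half_mem 0 (by simp))
      exact (intervalIntegral.integral_add_adjacent_intervals
        (intervalIntegrable_of_integrable_mu hf (by simp) hmid)
        (intervalIntegrable_of_integrable_mu hf hmid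
          (Ioc_subset_Icc_self (half_mem 1 hx)))).symm
    change antideriv f (half 1 x) = (1 * (∫ y, f (half 0 y) ∂mu) + antideriv (f ∘ half 1) x) / 2
    rw [hsplit, integral_half, integral_half, integral_mu, antideriv]
    simp only [Function.comp_apply]
    ring

theorem antiderivTr_half {f : ℝ → ℂ} (hf : Integrable f mu) (i : Fin 2) {x : ℝ}
    (hx : x ∈ Ioc (0 : ℝ) 1) : antiderivTr f (half i x) =
      (![1, 0] i * (∫ y, f (half i.rev y) ∂mu) + antiderivTr (f ∘ half i) x) / 2 := by
  have hadd := antideriv_add_antiderivTr hf (Ioc_subset_Icc_self (half_mem i hx))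
  have hadd_half :=
    antideriv_add_antiderivTr (integrable_comp_half hf i) (Ioc_subset_Icc_self hx)
  have hrev : ∫ y, f y ∂mu =
      ((∫ y, (f ∘ half i) y ∂mu) + ∫ y, f (half i.rev y) ∂mu) / 2 := by
    rw [integral_eq_integral_comp_half hf]
    fin_cases i
    · rfl
    · exact congrArg (· / 2) (add_comm _ _)
  have hcompl : (![1, 0] i : ℂ) = 1 - ![0, 1] i := by fin_cases i <;> simp
  rw [antideriv_half hf i hx] at hadd
  rw [hcompl]
  linear_combination hadd + hrev - hadd_half / 2

/-! ### The operators `C + a L + b L'` -/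

/-- The gate `a σ₋ + b σ₊`. -/
def offDiag (a b : ℂ) : Matrix (Fin 2) (Fin 2) ℂ := !![0, a; b, 0]

/-- The common form of `P₋` (`a = 1`, `b = 0`) and `P₊` (`a = 0`, `b = 1`). -/
def haarOp (a b : ℂ) (f : ℝ → ℂ) (x : ℝ) : ℂ :=
  period (offDiag a b) f x + a * antideriv f x + b * antiderivTr f x

theorem Pminus_eq_haarOp : Pminus = haarOp 1 0 := by
  funext f x
  simp only [Pminus, haarOp, one_mul, zero_mul, add_zero]
  rfl

theorem Pplus_eq_haarOp : Pplus = haarOp 0 1 := by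
  funext f x
  simp only [Pplus, haarOp, one_mul, zero_mul, add_zero]
  rfl

theorem haarOp_half (a b : ℂ) {f : ℝ → ℂ} (hf : Integrable f mu) (i : Fin 2) {x : ℝ}
    (hx : x ∈ Ioc (0 : ℝ) 1) (hs : Summable (periodTerm (offDiag a b) f (half i x))) :
    haarOp a b f (half i x) = (![a, b] i * f (half i.rev x) +
      ![b, a] i * (∫ y, f (half i.rev y) ∂mu) + haarOp a b (f ∘ half i) x) / 2 := by
  rw [haarOp, haarOp, period_half _ i hx hs, antideriv_half hf i hx, antiderivTr_half hf i hx]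
  fin_cases i <;> simp [offDiag] <;> ring

theorem haarOp_congr (a b : ℂ) {f g : ℝ → ℂ} (h : EqOn f g (Ioc 0 1)) :
    EqOn (haarOp a b f) (haarOp a b g) (Ioc 0 1) := by
  intro x hx
  have hterm : periodTerm (offDiag a b) f x = periodTerm (offDiag a b) g x := by
    funext k
    rw [periodTerm, periodTerm, gate_eq_sum _ k f hx, gate_eq_sum _ k g hx]
    simp only [h (setQubit_mem k _ hx)]
  have hL : antideriv f x = antideriv g x :=
    intervalIntegral.integral_congr_Ioo_of_le hx.1.le fun y hy => h ⟨hy.1, hy.2.le.trans hx.2⟩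
  have hL' : antiderivTr f x = antiderivTr g x :=
    intervalIntegral.integral_congr_Ioo_of_le hx.2 fun y hy => h ⟨hx.1.trans hy.1, hy.2.le⟩
  rw [haarOp, haarOp, period, period, hterm, hL, hL']

theorem haarOp_const_mul (a b c : ℂ) (f : ℝ → ℂ) {x : ℝ} (hx : x ∈ Ioc (0 : ℝ) 1) :
    haarOp a b (fun y => c * f y) x = c * haarOp a b f x := by
  have hterm (k : ℕ) : periodTerm (offDiag a b) (fun y => c * f y) x k =
      c * periodTerm (offDiag a b) f x k := by
    rw [periodTerm, periodTerm, gate_eq_sum _ k _ hx, gate_eq_sum _ k f hx, Finset.mul_sum,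
      Finset.mul_sum, Finset.mul_sum]
    exact Finset.sum_congr rfl fun _ _ => by ring
  simp only [haarOp, period, antideriv, antiderivTr, hterm, tsum_mul_left,
    intervalIntegral.integral_const_mul]
  ring

theorem eq_zero_of_norm_half_le {φ : ℝ → ℂ} {M : ℝ} (hM : ∀ x ∈ Ioc (0 : ℝ) 1, ‖φ x‖ ≤ M)
    (hφ : ∀ i, ∀ x ∈ Ioc (0 : ℝ) 1, ‖φ (half i x)‖ ≤ ‖φ x‖ / 2) :
    ∀ x ∈ Ioc (0 : ℝ) 1, φ x = 0 := by
  have hpow : ∀ n : ℕ, ∀ x ∈ Ioc (0 : ℝ) 1, ‖φ x‖ ≤ M * (1 / 2) ^ n := by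
    intro n
    induction n with
    | zero => simpa using hM
    | succ n ih =>
      intro x hx
      obtain ⟨i, y, hy, rfl⟩ := exists_half_eq hx
      have := hφ i y hy
      have := ih y hy
      rw [pow_succ]
      linarith
  intro x hx
  have hlim : Filter.Tendsto (fun n : ℕ => M * (1 / 2 : ℝ) ^ n) Filter.atTop (nhds (M * 0)) :=
    (tendsto_pow_atTop_nhds_zero_of_lt_one (by norm_num) (by norm_num)).const_mul M
  rw [mul_zero] at hlim
  exact norm_le_zero_iff.mp (ge_of_tendsto' hlim fun n => hpow n x hx)

theorem exists_norm_haarOp_le (a b : ℂ) {f : ℝ → ℂ} {M : ℝ} (hf : ∀ x, ‖f x‖ ≤ M)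
    (hint : Integrable f mu) : ∃ C, ∀ x ∈ Ioc (0 : ℝ) 1, ‖haarOp a b f x‖ ≤ C := by
  obtain ⟨C, hC⟩ := exists_norm_period_le (offDiag a b) hf
  refine ⟨C + ‖a‖ * (∫ y, ‖f y‖ ∂mu) + ‖b‖ * ∫ y, ‖f y‖ ∂mu, fun x hx => ?_⟩
  have hxI := Ioc_subset_Icc_self hx
  refine norm_add_le_of_le (norm_add_le_of_le (hC x hx) ?_) ?_
  · rw [norm_mul]
    exact mul_le_mul_of_nonneg_left (norm_intervalIntegral_le hint (by simp) hxI) (norm_nonneg a)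
  · rw [norm_mul]
    exact mul_le_mul_of_nonneg_left (norm_intervalIntegral_le hint hxI (by simp)) (norm_nonneg b)

theorem haarOp_const (a b c : ℂ) {x : ℝ} (hx : x ∈ Ioc (0 : ℝ) 1) :
    haarOp a b (fun _ => c) x = (a + b) * c := by
  obtain ⟨C, hC⟩ := exists_norm_haarOp_le a b (fun _ => le_refl ‖c‖) (integrable_const (μ := mu) c)
  have hhalf (i : Fin 2) (y : ℝ) (hy : y ∈ Ioc (0 : ℝ) 1) : haarOp a b (fun _ => c) (half i y) =
      ((a + b) * c + haarOp a b (fun _ => c) y) / 2 := by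
    rw [haarOp_half a b (integrable_const c) i hy
      (summable_periodTerm _ (fun _ => le_refl ‖c‖) (half_mem i hy))]
    fin_cases i <;> simp [Function.comp_def] <;> ring
  refine sub_eq_zero.mp (eq_zero_of_norm_half_le
    (φ := fun y => haarOp a b (fun _ => c) y - (a + b) * c) (M := C + ‖(a + b) * c‖)
    (fun y hy => norm_sub_le_of_le (hC y hy) le_rfl) (fun i y hy => le_of_eq ?_) x hx)
  rw [hhalf i y hy, ← Complex.norm_two, ← norm_div]
  congr 1
  ring

/-! ### Self-similarity of the Haar functions -/

theorem eqOn_Gfun_zero_zero : EqOn (Gfun 0 0) (fun _ => 1) (Ioc 0 1) := fun x hx => by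
  rw [Gfun_of_mem (k := 0) (by simpa [dyadic] using hx)]
  simp

theorem H_half (i : Fin 2) {x : ℝ} (hx : x ∈ Ioc (0 : ℝ) 1) : H (half i x) = ![1, -1] i := by
  have hmem : half i x ∈ dyadic 1 i := by
    rw [dyadic, half, mem_Ioc, pow_one]
    exact ⟨by linarith [hx.1], by linarith [hx.2]⟩
  rw [H, Gfun_of_mem hmem, Gfun_of_mem hmem]
  fin_cases i <;> simp

theorem H_of_notMem {x : ℝ} (hx : x ∉ Ioc (0 : ℝ) 1) : H x = 0 := by
  have hnot (k : ℕ) (hk : k ≤ 1) : x ∉ dyadic 1 k := fun h => by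
    have hk' : (k : ℝ) ≤ 1 := by exact_mod_cast hk
    refine hx ⟨lt_of_le_of_lt (by positivity) h.1, h.2.trans ?_⟩
    rw [pow_one]
    linarith
  rw [H, Gfun_of_notMem (hnot 0 zero_le_one), Gfun_of_notMem (hnot 1 le_rfl), sub_zero, zero_div]

theorem Hfun_zero (k : Fin (2 ^ 0)) : Hfun 0 k = H := by
  funext x
  simp [Hfun]

/-- The number of the dyadic interval of length `2⁻ⁿ⁻¹` that `half i` makes of the interval
number `k` of length `2⁻ⁿ`. -/
def child {n : ℕ} (i : Fin 2) (k : Fin (2 ^ n)) : Fin (2 ^ (n + 1)) :=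
  halves n (![Sum.inl k, Sum.inr k] i)

theorem val_child {n : ℕ} (i : Fin 2) (k : Fin (2 ^ n)) : (child i k : ℕ) = i * 2 ^ n + k := by
  fin_cases i <;> simp [child, halves, add_comm]

theorem exists_child_eq {n : ℕ} (l : Fin (2 ^ (n + 1))) : ∃ i k, child i k = l := by
  obtain ⟨k | k, rfl⟩ := (halves n).surjective l
  exacts [⟨0, k, rfl⟩, ⟨1, k, rfl⟩]

theorem sum_eq_sum_child {n : ℕ} {β : Type*} [AddCommMonoid β] (F : Fin (2 ^ (n + 1)) → β) :
    ∑ l, F l = ∑ i, ∑ k, F (child i k) := by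
  rw [← (halves n).sum_comp, Fintype.sum_sum_type, Fin.sum_univ_two]
  rfl

theorem Hfun_child_half {n : ℕ} (i j : Fin 2) (k : Fin (2 ^ n)) {x : ℝ}
    (hx : x ∈ Ioc (0 : ℝ) 1) :
    Hfun (n + 1) (child i k) (half j x) = if i = j then (√2 : ℂ) * Hfun n k x else 0 := by
  have harg : 2 ^ (n + 1) * half j x - ((child i k : ℕ) : ℝ) =
      2 ^ n * x - k + ((j : ℝ) - i) * 2 ^ n := by
    rw [val_child, half]
    push_cast
    ring
  rw [Hfun, harg]
  split_ifs with hij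
  · subst hij
    rw [sub_self, zero_mul, add_zero, Hfun]
    push_cast
    ring
  · have hk : ((k : ℕ) : ℝ) + 1 ≤ 2 ^ n := by exact_mod_cast k.2
    have hx1 : 2 ^ n * x ≤ 2 ^ n := mul_le_of_le_one_right (by positivity) hx.2
    have hx0 : 0 < 2 ^ n * x := mul_pos (by positivity) hx.1
    rw [H_of_notMem, mul_zero]
    rintro ⟨h0, h1⟩
    match i, j with
    | 0, 0 | 1, 1 => exact hij rfl
    | 0, 1 | 1, 0 =>
      norm_num at h0 h1
      linarith

theorem integrable_H : Integrable H mu :=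
  .of_bound measurable_H.aestronglyMeasurable 2 (.of_forall norm_H_le)

theorem integrable_Hfun (n k : ℕ) : Integrable (Hfun n k) mu :=
  (memLp_Hfun n k).integrable one_le_two

theorem integrable_mul_Hfun {f : ℝ → ℂ} (hf : Integrable f mu) (n k : ℕ) :
    Integrable (fun x => f x * Hfun n k x) mu :=
  hf.mul_bdd (measurable_Hfun n k).aestronglyMeasurable (.of_forall (norm_Hfun_le n k))

theorem integral_mul_Hfun_child {f : ℝ → ℂ} (hf : Integrable f mu) {n : ℕ} (i : Fin 2)
    (k : Fin (2 ^ n)) :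
    ∫ x, f x * Hfun (n + 1) (child i k) x ∂mu =
      √2 / 2 * ∫ x, f (half i x) * Hfun n k x ∂mu := by
  have hhalf (j : Fin 2) : ∫ x, f (half j x) * Hfun (n + 1) (child i k) (half j x) ∂mu =
      if i = j then (√2 : ℂ) * ∫ x, f (half i x) * Hfun n k x ∂mu else 0 := by
    rw [setIntegral_congr_fun measurableSet_Ioc fun x hx =>
      congrArg (f (half j x) * ·) (Hfun_child_half i j k hx)]
    split_ifs with hij
    · subst hij
      rw [← integral_const_mul]
      exact integral_congr_ae (.of_forall fun x => mul_left_comm _ _ _)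
    · simp
  rw [integral_eq_integral_comp_half (integrable_mul_Hfun hf _ _), hhalf, hhalf]
  fin_cases i <;> simp <;> ring

theorem integral_mul_H {f : ℝ → ℂ} (hf : Integrable f mu) :
    ∫ x, f x * H x ∂mu = ((∫ x, f (half 0 x) ∂mu) - ∫ x, f (half 1 x) ∂mu) / 2 := by
  have hint : Integrable (fun x => f x * H x) mu :=
    hf.mul_bdd measurable_H.aestronglyMeasurable (.of_forall norm_H_le)
  have hhalf (i : Fin 2) : ∫ x, f (half i x) * H (half i x) ∂mu =
      (∫ x, f (half i x) ∂mu) * ![1, -1] i := by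
    rw [← integral_mul_const]
    exact setIntegral_congr_fun measurableSet_Ioc fun x hx =>
      congrArg (f (half i x) * ·) (H_half i hx)
  rw [integral_eq_integral_comp_half hint, hhalf, hhalf]
  simp [sub_eq_add_neg]

theorem integral_Hfun (n : ℕ) (k : Fin (2 ^ n)) : ∫ x, Hfun n k x ∂mu = 0 := by
  induction n with
  | zero =>
    rw [Hfun_zero]
    simpa using integral_mul_H (integrable_const (1 : ℂ))
  | succ n ih =>
    obtain ⟨i, k, rfl⟩ := exists_child_eq k
    simpa [ih] using integral_mul_Hfun_child (integrable_const (1 : ℂ)) i k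

/-! ### The action on the Haar functions -/

/-- The matrix of `haarOp a b` in the basis `(H_{n,k})_k` of `W_n`. -/
def blockMatrix (a b : ℂ) : ∀ n : ℕ, Matrix (Fin (2 ^ n)) (Fin (2 ^ n)) ℂ
  | 0 => 0
  | n + 1 => (1 / 2 : ℂ) • Matrix.reindex (halves n) (halves n)
      (Matrix.fromBlocks (blockMatrix a b n) (a • 1) (b • 1) (blockMatrix a b n))

theorem blockMatrix_child (a b : ℂ) {n : ℕ} (i j : Fin 2) (k l : Fin (2 ^ n)) :
    blockMatrix a b (n + 1) (child i k) (child j l) =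
      (if i = j then blockMatrix a b n k l else if k = l then ![a, b] i else 0) / 2 := by
  fin_cases i <;> fin_cases j <;>
    simp [blockMatrix, child, Matrix.one_apply, div_eq_inv_mul]

theorem conjTranspose_blockMatrix (a b : ℂ) (n : ℕ) :
    (blockMatrix a b n).conjTranspose = blockMatrix (star b) (star a) n := by
  induction n with
  | zero => exact Matrix.conjTranspose_zero
  | succ n ih =>
    simp only [blockMatrix, Matrix.conjTranspose_smul, Matrix.conjTranspose_reindex,
      Matrix.fromBlocks_conjTranspose, ih, Matrix.conjTranspose_one]
    simp

theorem haarOp_H (a b : ℂ) {x : ℝ} (hx : x ∈ Ioc (0 : ℝ) 1) : haarOp a b H x = 0 := by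
  obtain ⟨i, y, hy, rfl⟩ := exists_half_eq hx
  have hcomp : EqOn (H ∘ half i) (fun _ => ![1, -1] i) (Ioc 0 1) := fun z hz => H_half i hz
  have hintegral : ∫ z, H (half i.rev z) ∂mu = ![1, -1] i.rev := by
    rw [setIntegral_congr_fun measurableSet_Ioc fun z hz => H_half i.rev hz]
    simp
  rw [haarOp_half a b integrable_H i hy (summable_periodTerm _ norm_H_le (half_mem i hy)),
    haarOp_congr a b hcomp hy, haarOp_const a b _ hy, hintegral, H_half i.rev hy]
  fin_cases i <;> simp <;> ring

theorem sum_mul_Hfun_half {n : ℕ} (c : Fin (2 ^ (n + 1)) → ℂ) (j : Fin 2) {x : ℝ}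
    (hx : x ∈ Ioc (0 : ℝ) 1) :
    ∑ l, c l * Hfun (n + 1) l (half j x) = √2 * ∑ l, c (child j l) * Hfun n l x := by
  rw [sum_eq_sum_child, Finset.sum_eq_single j, Finset.mul_sum]
  · refine Finset.sum_congr rfl fun l _ => ?_
    rw [Hfun_child_half j j l hx, if_pos rfl, mul_left_comm]
  · intro m _ hmj
    refine Finset.sum_eq_zero fun l _ => ?_
    rw [Hfun_child_half m j l hx, if_neg hmj, mul_zero]
  · simp

theorem haarOp_Hfun_child_half (a b : ℂ) {n : ℕ} (i j : Fin 2) (k : Fin (2 ^ n)) {x : ℝ}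
    (hx : x ∈ Ioc (0 : ℝ) 1) :
    haarOp a b (Hfun (n + 1) (child i k)) (half j x) =
      √2 * (if i = j then haarOp a b (Hfun n k) x else ![a, b] j * Hfun n k x) / 2 := by
  have hintegral : ∫ y, Hfun (n + 1) (child i k) (half j.rev y) ∂mu = 0 := by
    rw [setIntegral_congr_fun measurableSet_Ioc fun y hy => Hfun_child_half i j.rev k hy]
    split_ifs
    · rw [integral_const_mul, integral_Hfun, mul_zero]
    · exact integral_zero _ _
  have hcomp : haarOp a b (Hfun (n + 1) (child i k) ∘ half j) x =
      if i = j then √2 * haarOp a b (Hfun n k) x else 0 := by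
    have hcongr : EqOn (Hfun (n + 1) (child i k) ∘ half j)
        (fun y => if i = j then √2 * Hfun n k y else 0) (Ioc 0 1) :=
      fun y hy => Hfun_child_half i j k hy
    rw [haarOp_congr a b hcongr hx]
    split_ifs
    · exact haarOp_const_mul a b _ _ hx
    · rw [haarOp_const a b 0 hx, mul_zero]
  rw [haarOp_half a b (integrable_Hfun _ _) j hx
    (summable_periodTerm _ (norm_Hfun_le _ _) (half_mem j hx)), hintegral, hcomp,
    Hfun_child_half i j.rev k hx]
  have hrev : i = j.rev ↔ i ≠ j := by
    rw [ne_eq, Fin.ext_iff, Fin.ext_iff, Fin.val_rev]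
    omega
  simp only [hrev, ite_not]
  split_ifs <;> ring

theorem haarOp_Hfun (a b : ℂ) (n : ℕ) (k : Fin (2 ^ n)) {x : ℝ} (hx : x ∈ Ioc (0 : ℝ) 1) :
    haarOp a b (Hfun n k) x = ∑ l, blockMatrix a b n l k * Hfun n l x := by
  induction n generalizing x with
  | zero =>
    rw [Hfun_zero, haarOp_H a b hx]
    exact (Finset.sum_eq_zero fun l _ => mul_eq_zero_of_left rfl _).symm
  | succ n ih =>
    obtain ⟨i, k, rfl⟩ := exists_child_eq k
    obtain ⟨j, y, hy, rfl⟩ := exists_half_eq hx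
    rw [haarOp_Hfun_child_half a b i j k hy, sum_mul_Hfun_half _ j hy, mul_div_assoc]
    congr 1
    simp only [blockMatrix_child, div_mul_eq_mul_div, ← Finset.sum_div, eq_comm (a := j)]
    split_ifs
    · rw [ih k hy]
    · simp only [ite_mul, zero_mul, Finset.sum_ite_eq', Finset.mem_univ, if_true]

/-! ### The Haar basis -/

theorem integral_Hfun_child_mul_Hfun_child {n m : ℕ} (i j : Fin 2) (k : Fin (2 ^ n))
    (l : Fin (2 ^ m)) :
    ∫ x, Hfun (n + 1) (child i k) x * Hfun (m + 1) (child j l) x ∂mu =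
      if i = j then ∫ x, Hfun n k x * Hfun m l x ∂mu else 0 := by
  have hsqrt : (√2 / 2 * √2 : ℂ) = 1 := by
    rw [div_mul_eq_mul_div, ← Complex.ofReal_mul, Real.mul_self_sqrt zero_le_two]
    simp
  rw [integral_mul_Hfun_child (integrable_Hfun _ _), setIntegral_congr_fun measurableSet_Ioc
    fun x hx => congrArg (· * Hfun m l x) (Hfun_child_half i j k hx)]
  split_ifs
  · simp only [mul_assoc]
    rw [integral_const_mul, ← mul_assoc, hsqrt, one_mul]
  · simp

theorem integral_H_mul_Hfun_child {n : ℕ} (i : Fin 2) (k : Fin (2 ^ n)) :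
    ∫ x, H x * Hfun (n + 1) (child i k) x ∂mu = 0 := by
  rw [integral_mul_Hfun_child integrable_H, setIntegral_congr_fun measurableSet_Ioc
    fun x hx => congrArg (· * Hfun n k x) (H_half i hx), integral_const_mul, integral_Hfun,
    mul_zero, mul_zero]

theorem integral_H_mul_H : ∫ x, H x * H x ∂mu = 1 := by
  rw [integral_mul_H integrable_H, setIntegral_congr_fun measurableSet_Ioc fun x hx => H_half 0 hx,
    setIntegral_congr_fun measurableSet_Ioc fun x hx => H_half 1 hx]
  norm_num

theorem integral_Hfun_mul_self (n : ℕ) (k : Fin (2 ^ n)) :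
    ∫ x, Hfun n k x * Hfun n k x ∂mu = 1 := by
  induction n with
  | zero => rw [Hfun_zero, integral_H_mul_H]
  | succ n ih =>
    obtain ⟨i, k, rfl⟩ := exists_child_eq k
    rw [integral_Hfun_child_mul_Hfun_child, if_pos rfl, ih]

theorem integral_Hfun_mul_Hfun_of_ne {n m : ℕ} {k : Fin (2 ^ n)} {l : Fin (2 ^ m)}
    (h : (⟨n, k⟩ : Σ n, Fin (2 ^ n)) ≠ ⟨m, l⟩) : ∫ x, Hfun n k x * Hfun m l x ∂mu = 0 := by
  induction n generalizing m with
  | zero =>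
    rw [Hfun_zero]
    cases m with
    | zero => exact absurd (congrArg (Sigma.mk 0) (Subsingleton.elim (α := Fin 1) k l)) h
    | succ m =>
      obtain ⟨j, l, rfl⟩ := exists_child_eq l
      exact integral_H_mul_Hfun_child j l
  | succ n ih =>
    obtain ⟨i, k, rfl⟩ := exists_child_eq k
    cases m with
    | zero =>
      simp only [Hfun_zero, mul_comm _ (H _)]
      exact integral_H_mul_Hfun_child i k
    | succ m =>
      obtain ⟨j, l, rfl⟩ := exists_child_eq l
      rw [integral_Hfun_child_mul_Hfun_child]
      split_ifs with hij
      · subst hij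
        refine ih fun hkl => h ?_
        cases hkl
        rfl
      · rfl

theorem integral_mul_Gfun_zero_zero (f : ℝ → ℂ) : ∫ x, f x * Gfun 0 0 x ∂mu = ∫ x, f x ∂mu :=
  setIntegral_congr_fun measurableSet_Ioc fun x hx => by
    rw [eqOn_Gfun_zero_zero hx, mul_one]

/-- The Haar functions as elements of `L₂(0,1]`. -/
def haarVec : HaarIndex → L2
  | none => gVec 0 0
  | some ⟨n, k⟩ => hVec n k

theorem coeFn_haarVec (i : HaarIndex) : (haarVec i : ℝ → ℂ) =ᵐ[mu] haarFun i := by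
  match i with
  | none => exact (memLp_Gfun 0 0).coeFn_toLp
  | some ⟨n, k⟩ => exact (memLp_Hfun n k).coeFn_toLp

theorem conj_Gfun (n k : ℕ) (x : ℝ) : (starRingEnd ℂ) (Gfun n k x) = Gfun n k x := by
  by_cases hx : 2 ^ n * x - k ∈ Ioc (0 : ℝ) 1 <;> simp [Gfun, G, hx]

theorem conj_haarFun (i : HaarIndex) (x : ℝ) : (starRingEnd ℂ) (haarFun i x) = haarFun i x := by
  match i with
  | none => exact conj_Gfun 0 0 x
  | some ⟨n, k⟩ => simp [haarFun, Hfun, H, conj_Gfun]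

theorem inner_haarVec (i : HaarIndex) (f : L2) :
    inner ℂ (haarVec i) f = ∫ x, f x * haarFun i x ∂mu := by
  rw [L2.inner_def]
  refine integral_congr_ae ?_
  filter_upwards [coeFn_haarVec i] with x hx
  rw [RCLike.inner_apply, hx, conj_haarFun]

theorem inner_haarVec_haarVec (i j : HaarIndex) :
    inner ℂ (haarVec i) (haarVec j) = ∫ x, haarFun j x * haarFun i x ∂mu := by
  rw [inner_haarVec]
  refine integral_congr_ae ?_
  filter_upwards [coeFn_haarVec j] with x hx
  rw [hx]

theorem orthonormal_haarVec : Orthonormal ℂ haarVec := by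
  rw [orthonormal_iff_ite]
  intro i j
  rw [inner_haarVec_haarVec]
  match i, j with
  | none, none =>
    exact (integral_mul_Gfun_zero_zero _).trans <|
      (setIntegral_congr_fun measurableSet_Ioc eqOn_Gfun_zero_zero).trans (by simp)
  | none, some ⟨n, k⟩ => exact (integral_mul_Gfun_zero_zero _).trans (integral_Hfun n k)
  | some ⟨n, k⟩, none =>
    exact (integral_congr_ae (.of_forall fun x => mul_comm _ _)).trans <|
      (integral_mul_Gfun_zero_zero _).trans (integral_Hfun n k)
  | some ⟨n, k⟩, some ⟨m, l⟩ =>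
    split_ifs with h
    · cases h
      exact integral_Hfun_mul_self n k
    · exact integral_Hfun_mul_Hfun_of_ne fun hlk => h (congrArg some hlk.symm)

theorem integral_comp_half_mul_haarFun {f : ℝ → ℂ} (hf : Integrable f mu)
    (h : ∀ i, ∫ x, f x * haarFun i x ∂mu = 0) (i : Fin 2) (j : HaarIndex) :
    ∫ x, f (half i x) * haarFun j x ∂mu = 0 := by
  match j with
  | none =>
    have hmean : ∫ x, f x ∂mu = 0 := (integral_mul_Gfun_zero_zero f).symm.trans (h none)
    have hH : ∫ x, f x * H x ∂mu = 0 := by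
      rw [← Hfun_zero 0]
      exact h (some ⟨0, 0⟩)
    rw [integral_eq_integral_comp_half hf] at hmean
    rw [integral_mul_H hf] at hH
    refine (integral_mul_Gfun_zero_zero _).trans ?_
    match i with
    | 0 => linear_combination hmean + hH
    | 1 => linear_combination hmean - hH
  | some ⟨n, k⟩ =>
    have hchild := h (some ⟨n + 1, child i k⟩)
    rw [haarFun, integral_mul_Hfun_child hf] at hchild
    exact (mul_eq_zero.mp hchild).resolve_left (by simp)

theorem map_half_mu_le (i : Fin 2) : mu.map (half i) ≤ (2 : ENNReal) • mu := by
  conv_rhs => rw [mu_eq_map_half]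
  rw [smul_smul, ENNReal.mul_inv_cancel (by simp) (by simp), one_smul]
  match i with
  | 0 => exact Measure.le_add_right le_rfl
  | 1 => exact Measure.le_add_left le_rfl

theorem eLpNorm_comp_half_le {f : ℝ → ℂ} (hf : AEStronglyMeasurable f mu) (i : Fin 2) :
    eLpNorm (f ∘ half i) 2 mu ≤ 2 ^ (1 / 2 : ℝ) * eLpNorm f 2 mu := by
  have hmeas : AEStronglyMeasurable f (mu.map (half i)) :=
    (hf.smul_measure _).mono_measure (map_half_mu_le i)
  rw [← eLpNorm_map_measure hmeas (measurable_half i).aemeasurable]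
  refine (eLpNorm_mono_measure f (map_half_mu_le i)).trans_eq ?_
  rw [eLpNorm_smul_measure_of_ne_top (by simp), smul_eq_mul]
  norm_num

theorem memLp_comp_half {f : ℝ → ℂ} (hf : MemLp f 2 mu) (i : Fin 2) :
    MemLp (f ∘ half i) 2 mu :=
  ⟨(integrable_comp_half (hf.integrable one_le_two) i).aestronglyMeasurable,
    (eLpNorm_comp_half_le hf.1 i).trans_lt
      (ENNReal.mul_lt_top (ENNReal.rpow_lt_top_of_nonneg (by simp) (by simp)) hf.2)⟩

theorem enorm_antideriv_le {f : ℝ → ℂ} (hf : MemLp f 2 mu) {x : ℝ} (hx : x ∈ Ioc (0 : ℝ) 1) :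
    ‖antideriv f x‖ₑ ≤ eLpNorm f 2 mu := by
  have hint := hf.integrable one_le_two
  calc ‖antideriv f x‖ₑ = ENNReal.ofReal ‖antideriv f x‖ := (ofReal_norm _).symm
    _ ≤ ENNReal.ofReal (∫ y, ‖f y‖ ∂mu) := ENNReal.ofReal_le_ofReal <|
      norm_intervalIntegral_le hint (by simp) (Ioc_subset_Icc_self hx)
    _ = eLpNorm f 1 mu := by
      rw [ofReal_integral_norm_eq_lintegral_enorm hint, eLpNorm_one_eq_lintegral_enorm]
    _ ≤ eLpNorm f 2 mu := eLpNorm_le_eLpNorm_of_exponent_le one_le_two hf.1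

-- If all Haar coefficients of `f` vanish, so do those of `f ∘ half i`. Passing to a half therefore
-- divides the antiderivative by `2`, while the `L₂` norm grows by a factor of at most `√2`.
theorem enorm_antideriv_le_pow (n : ℕ) {f : ℝ → ℂ} (hf : MemLp f 2 mu)
    (h : ∀ i, ∫ x, f x * haarFun i x ∂mu = 0) {x : ℝ} (hx : x ∈ Ioc (0 : ℝ) 1) :
    ‖antideriv f x‖ₑ ≤ (2⁻¹ * 2 ^ (1 / 2 : ℝ)) ^ n * eLpNorm f 2 mu := by
  induction n generalizing f x with
  | zero => simpa using enorm_antideriv_le hf hx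
  | succ n ih =>
    obtain ⟨i, y, hy, rfl⟩ := exists_half_eq hx
    have hint := hf.integrable one_le_two
    have hmean : ∫ y, f (half i.rev y) ∂mu = 0 :=
      (integral_mul_Gfun_zero_zero _).symm.trans
        (integral_comp_half_mul_haarFun hint h i.rev none)
    rw [antideriv_half hint i hy, hmean, mul_zero, zero_add, div_eq_inv_mul, enorm_mul]
    calc ‖(2⁻¹ : ℂ)‖ₑ * ‖antideriv (f ∘ half i) y‖ₑ
        ≤ 2⁻¹ * ((2⁻¹ * 2 ^ (1 / 2 : ℝ)) ^ n * (2 ^ (1 / 2 : ℝ) * eLpNorm f 2 mu)) := by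
          gcongr
          · rw [enorm_inv two_ne_zero]
            simp [enorm]
          · exact (ih (memLp_comp_half hf i) (integral_comp_half_mul_haarFun hint h i) hy).trans
              (mul_le_mul_right (eLpNorm_comp_half_le hf.1 i) _)
      _ = (2⁻¹ * 2 ^ (1 / 2 : ℝ)) ^ (n + 1) * eLpNorm f 2 mu := by ring

theorem antideriv_eq_zero_of_integral_mul_haarFun {f : ℝ → ℂ} (hf : MemLp f 2 mu)
    (h : ∀ i, ∫ x, f x * haarFun i x ∂mu = 0) {x : ℝ} (hx : x ∈ Ioc (0 : ℝ) 1) :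
    antideriv f x = 0 := by
  have hlt : (2⁻¹ * 2 ^ (1 / 2 : ℝ) : ENNReal) < 1 := by
    rw [← ENNReal.rpow_neg_one, ← ENNReal.rpow_add _ _ (by simp) (by simp)]
    exact ENNReal.rpow_lt_one_of_one_lt_of_neg (by simp) (by norm_num)
  have hlim := ENNReal.Tendsto.mul_const (b := eLpNorm f 2 mu)
    (ENNReal.tendsto_pow_atTop_nhds_zero_of_lt_one hlt) (Or.inr hf.2.ne)
  rw [zero_mul] at hlim
  exact enorm_eq_zero.mp <| le_zero_iff.mp <|
    ge_of_tendsto' hlim fun n => enorm_antideriv_le_pow n hf h hx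

theorem ae_eq_zero_of_antideriv_eq_zero {f : ℝ → ℂ} (hf : Integrable f mu)
    (h : ∀ x ∈ Ioc (0 : ℝ) 1, antideriv f x = 0) : f =ᵐ[mu] 0 := by
  have hI := intervalIntegrable_of_integrable_mu hf (x := 0) (y := 1) (by simp) (by simp)
  have hne : ∀ᵐ x : ℝ, x ≠ 1 := by simp [ae_iff]
  filter_upwards [ae_restrict_of_ae hI.ae_hasDerivAt_integral, ae_restrict_of_ae hne,
    ae_restrict_mem measurableSet_Ioc] with x hderiv hx1 hx
  have hfx : HasDerivAt (antideriv f) (f x) x :=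
    hderiv (by rw [uIcc_of_le zero_le_one]; exact Ioc_subset_Icc_self hx) 0 (by simp)
  have hev : antideriv f =ᶠ[nhds x] fun _ => 0 := by
    filter_upwards [Ioo_mem_nhds hx.1 (lt_of_le_of_ne hx.2 hx1)] with y hy
    exact h y (Ioo_subset_Ioc_self hy)
  exact hfx.unique ((hasDerivAt_const x (0 : ℂ)).congr_of_eventuallyEq hev)

theorem span_haarVec_orthogonal : (Submodule.span ℂ (range haarVec))ᗮ = ⊥ := by
  rw [Submodule.eq_bot_iff]
  intro f hf
  have hcoeff (i : HaarIndex) : ∫ x, f x * haarFun i x ∂mu = 0 := by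
    rw [← inner_haarVec]
    exact Submodule.inner_right_of_mem_orthogonal (Submodule.subset_span (mem_range_self i)) hf
  exact (Lp.eq_zero_iff_ae_eq_zero).mpr <|
    ae_eq_zero_of_antideriv_eq_zero ((Lp.memLp f).integrable one_le_two) fun x hx =>
      antideriv_eq_zero_of_integral_mul_haarFun (Lp.memLp f) hcoeff hx

/-- The Haar functions as a Hilbert basis; its `repr` is the Haar transform. -/
def haarBasis : HilbertBasis HaarIndex ℂ L2 :=
  HilbertBasis.mkOfOrthogonalEqBot orthonormal_haarVec span_haarVec_orthogonal

theorem coe_haarBasis : ⇑haarBasis = haarVec :=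
  HilbertBasis.coe_mkOfOrthogonalEqBot orthonormal_haarVec span_haarVec_orthogonal

theorem haarBasis_repr_apply (f : L2) (i : HaarIndex) :
    haarBasis.repr f i = inner ℂ (haarVec i) f := by
  rw [HilbertBasis.repr_apply_apply, coe_haarBasis]

theorem isHaarTransform_repr : IsHaarTransform haarBasis.repr := fun f i => by
  rw [haarBasis_repr_apply, inner_haarVec]

theorem dense_span_haarVec : Dense (Submodule.span ℂ (range haarVec) : Set L2) := by
  rw [← coe_haarBasis]
  exact Submodule.dense_iff_topologicalClosure_eq_top.mpr haarBasis.dense_span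

/-! ### Block diagonal operators -/

theorem ext_inner_haarVec {u v : L2} (h : ∀ i, inner ℂ (haarVec i) u = inner ℂ (haarVec i) v) :
    u = v :=
  haarBasis.repr.injective <| lp.ext <| funext fun i => by
    rw [haarBasis_repr_apply, haarBasis_repr_apply, h]

theorem inner_haarVec_eq_ite (i j : HaarIndex) :
    inner ℂ (haarVec i) (haarVec j) = if i = j then (1 : ℂ) else 0 :=
  orthonormal_iff_ite.mp orthonormal_haarVec i j

theorem inner_haarVec_some_of_ne {n m : ℕ} (h : n ≠ m) (j : Fin (2 ^ n)) (k : Fin (2 ^ m)) :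
    inner ℂ (haarVec (some ⟨n, j⟩)) (haarVec (some ⟨m, k⟩)) = 0 := by
  rw [inner_haarVec_eq_ite, if_neg]
  intro hjk
  cases hjk
  exact h rfl

/-- `A` is given in the Haar basis by the matrix `[1] ⊕ ⨁ₙ M n`. -/
structure HasBlocks (A : L2 →L[ℂ] L2) (M : ∀ n : ℕ, Matrix (Fin (2 ^ n)) (Fin (2 ^ n)) ℂ) :
    Prop where
  map_none : A (haarVec none) = haarVec none
  map_some : ∀ (n : ℕ) (k : Fin (2 ^ n)),
    A (haarVec (some ⟨n, k⟩)) = ∑ j, M n j k • haarVec (some ⟨n, j⟩)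

namespace HasBlocks

variable {A B : L2 →L[ℂ] L2} {M : ∀ n : ℕ, Matrix (Fin (2 ^ n)) (Fin (2 ^ n)) ℂ}

theorem unique (hA : HasBlocks A M) (hB : HasBlocks B M) : A = B := by
  refine ContinuousLinearMap.ext_on dense_span_haarVec ?_
  rintro _ ⟨_ | ⟨n, k⟩, rfl⟩
  · rw [hA.map_none, hB.map_none]
  · rw [hA.map_some, hB.map_some]

theorem adjoint (h : HasBlocks A M) :
    HasBlocks (ContinuousLinearMap.adjoint A) fun n => (M n).conjTranspose where
  map_none := ext_inner_haarVec fun i => by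
    rw [ContinuousLinearMap.adjoint_inner_right]
    match i with
    | none => rw [h.map_none]
    | some ⟨m, l⟩ => simp [h.map_some, sum_inner, inner_smul_left, inner_haarVec_eq_ite]
  map_some n k := ext_inner_haarVec fun i => by
    rw [ContinuousLinearMap.adjoint_inner_right]
    match i with
    | none => simp [h.map_none, inner_sum, inner_smul_right, inner_haarVec_eq_ite]
    | some ⟨m, l⟩ =>
      rw [h.map_some, sum_inner, inner_sum]
      simp only [inner_smul_left, inner_smul_right]
      by_cases hmn : m = n
      · subst hmn
        simp [inner_haarVec_eq_ite, Matrix.conjTranspose_apply]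
      · simp [inner_haarVec_some_of_ne hmn]

theorem block_eq (h : HasBlocks A M) : block A = M := by
  funext n
  ext j k
  change inner ℂ (haarVec (some ⟨n, j⟩)) (A (haarVec (some ⟨n, k⟩))) = M n j k
  simp [h.map_some, inner_sum, inner_smul_right, inner_haarVec_eq_ite]

theorem map_V_zero (h : HasBlocks A M) : (V 0).map (A : L2 →ₗ[ℂ] L2) = V 0 := by
  have hV : (range fun k : Fin (2 ^ 0) => gVec 0 k) = {haarVec none} :=
    range_unique (ι := Fin 1) (f := fun k => gVec 0 k)
  rw [V, hV, Submodule.map_span, image_singleton]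
  exact congrArg (fun v => Submodule.span ℂ {v}) h.map_none

theorem map_W_le (h : HasBlocks A M) (n : ℕ) : (W n).map (A : L2 →ₗ[ℂ] L2) ≤ W n := by
  rw [W, Submodule.map_span, Submodule.span_le]
  rintro _ ⟨_, ⟨k, rfl⟩, rfl⟩
  change A (haarVec (some ⟨n, k⟩)) ∈ _
  rw [h.map_some]
  exact Submodule.sum_mem _ fun j _ =>
    Submodule.smul_mem _ _ (Submodule.subset_span (mem_range_self j))

theorem repr_apply (h : HasBlocks A M) (f : L2) :
    (haarBasis.repr (A f) : HaarIndex → ℂ) = blockSum M (haarBasis.repr f) := by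
  funext i
  rw [haarBasis_repr_apply, ← ContinuousLinearMap.adjoint_inner_left]
  match i with
  | none => rw [h.adjoint.map_none, blockSum, haarBasis_repr_apply]
  | some ⟨n, k⟩ =>
    simp only [h.adjoint.map_some, sum_inner, inner_smul_left, blockSum, Matrix.mulVec,
      dotProduct, haarBasis_repr_apply, Matrix.conjTranspose_apply, RCLike.star_def,
      RCLike.conj_conj]

theorem exists_blockSum (h : HasBlocks A M) :
    ∃ B : l2 →L[ℂ] l2, (∀ c : l2, (B c : HaarIndex → ℂ) = blockSum (block A) c) ∧
      ∀ f : L2, A f = haarBasis.repr.symm (B (haarBasis.repr f)) := by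
  let T : L2 ≃L[ℂ] l2 := haarBasis.repr.toContinuousLinearEquiv
  refine ⟨(T : L2 →L[ℂ] l2) ∘L A ∘L (T.symm : l2 →L[ℂ] L2), fun c => ?_, fun f => ?_⟩
  · rw [h.block_eq]
    refine (h.repr_apply (haarBasis.repr.symm c)).trans ?_
    rw [LinearIsometryEquiv.apply_symm_apply]
  · exact ((T.symm_apply_apply _).trans (congrArg A (T.symm_apply_apply f))).symm

end HasBlocks

/-! ### The operators `P₋` and `P₊` -/

theorem exists_continuousLinearMap_haarOp (a b : ℂ) :
    ∃ A : L2 →L[ℂ] L2, ∀ (f : ℝ → ℂ) (hf : MemLp f 2 mu),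
      (∀ᵐ x ∂mu, Summable (periodTerm (offDiag a b) f x)) ∧
      ∀ᵐ x ∂mu, (A hf.toLp : ℝ → ℂ) x = haarOp a b f x := by
  obtain ⟨C, hC⟩ := exists_continuousLinearMap_period (offDiag a b)
  obtain ⟨L, hL⟩ := exists_continuousLinearMap_antideriv
  obtain ⟨L', hL'⟩ := exists_continuousLinearMap_antiderivTr
  refine ⟨C + a • L + b • L', fun f hf => ⟨(hC f hf).mono fun x hx => hx.summable, ?_⟩⟩
  rw [add_apply, add_apply, smul_apply, smul_apply]
  filter_upwards [hC f hf, hL f hf, hL' f hf,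
    Lp.coeFn_add (C hf.toLp + a • L hf.toLp) (b • L' hf.toLp),
    Lp.coeFn_add (C hf.toLp) (a • L hf.toLp), Lp.coeFn_smul a (L hf.toLp),
    Lp.coeFn_smul b (L' hf.toLp)] with x hCx hLx hLx' hadd hadd' hsmul hsmul'
  rw [hadd, Pi.add_apply, hadd', Pi.add_apply, hsmul, hsmul', Pi.smul_apply, Pi.smul_apply, hLx,
    hLx', ← hCx.tsum_eq]
  rfl

theorem hasBlocks_of_ae_eq_haarOp {a b : ℂ} (hab : a + b = 1) {A : L2 →L[ℂ] L2}
    (hA : ∀ (f : ℝ → ℂ) (hf : MemLp f 2 mu), ∀ᵐ x ∂mu, (A hf.toLp : ℝ → ℂ) x = haarOp a b f x) :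
    HasBlocks A (blockMatrix a b) where
  map_none := Lp.ext <| by
    filter_upwards [hA _ (memLp_Gfun 0 0), coeFn_haarVec none, ae_restrict_mem measurableSet_Ioc]
      with x hAx hGx hx
    rw [hGx, haarFun, eqOn_Gfun_zero_zero hx]
    exact hAx.trans <| (haarOp_congr a b eqOn_Gfun_zero_zero hx).trans <| by
      rw [haarOp_const a b 1 hx, hab, mul_one]
  map_some n k := Lp.ext <| by
    have hsmul : ∀ᵐ x ∂mu, ∀ j, (blockMatrix a b n j k • haarVec (some ⟨n, j⟩) : L2) x =
        blockMatrix a b n j k * Hfun n j x := ae_all_iff.mpr fun j => by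
      filter_upwards [Lp.coeFn_smul (blockMatrix a b n j k) (haarVec (some ⟨n, j⟩)),
        coeFn_haarVec (some ⟨n, j⟩)] with x hx hHx
      rw [hx, Pi.smul_apply, hHx, smul_eq_mul, haarFun]
    filter_upwards [hA _ (memLp_Hfun n k), hsmul, ae_restrict_mem measurableSet_Ioc,
      Lp.coeFn_fun_finsetSum Finset.univ fun j => blockMatrix a b n j k • haarVec (some ⟨n, j⟩)]
      with x hAx hsmulx hx hsumx
    rw [hsumx]
    exact hAx.trans <| (haarOp_Hfun a b n k hx).trans <|
      Finset.sum_congr rfl fun j _ => (hsmulx j).symm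

theorem exists_hasBlocks_haarOp {a b : ℂ} (hab : a + b = 1) :
    ∃ A : L2 →L[ℂ] L2, HasBlocks A (blockMatrix a b) ∧ ∀ (f : ℝ → ℂ) (hf : MemLp f 2 mu),
      (∀ᵐ x ∂mu, Summable (periodTerm (offDiag a b) f x)) ∧
      ∀ᵐ x ∂mu, (A hf.toLp : ℝ → ℂ) x = haarOp a b f x := by
  obtain ⟨A, hA⟩ := exists_continuousLinearMap_haarOp a b
  exact ⟨A, hasBlocks_of_ae_eq_haarOp hab fun f hf => (hA f hf).2, hA⟩

theorem adjoint_eq_of_hasBlocks {a b : ℂ} {A B : L2 →L[ℂ] L2} (hA : HasBlocks A (blockMatrix a b))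
    (hB : HasBlocks B (blockMatrix (star b) (star a))) : ContinuousLinearMap.adjoint A = B := by
  refine hA.adjoint.unique ?_
  simpa only [conjTranspose_blockMatrix] using hB

end

end HaarQubit

theorem theorem3p1 :
    ∃ (T : L2 ≃ₗᵢ[ℂ] l2) (Pm Pp : L2 →L[ℂ] L2),
      IsHaarTransform T ∧
      -- `Pm` and `Pp` are given by the formulas for `P₋` and `P₊`, on all of `L₂(0,1]`
      (∀ (f : ℝ → ℂ) (hf : MemLp f 2 mu),
        (∀ᵐ x ∂mu, Summable (periodTerm sigmaMinus f x)) ∧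
        (∀ᵐ x ∂mu, (Pm hf.toLp : ℝ → ℂ) x = Pminus f x) ∧
        (∀ᵐ x ∂mu, Summable (periodTerm sigmaPlus f x)) ∧
        (∀ᵐ x ∂mu, (Pp hf.toLp : ℝ → ℂ) x = Pplus f x)) ∧
      -- block structure of `P₋`
      (∃ B : l2 →L[ℂ] l2, (∀ c : l2, (B c : HaarIndex → ℂ) = blockSum (block Pm) c) ∧
        ∀ f : L2, Pm f = T.symm (B (T f))) ∧
      (V 0).map (Pm : L2 →ₗ[ℂ] L2) = V 0 ∧
      (∀ n, (W n).map (Pm : L2 →ₗ[ℂ] L2) ≤ W n) ∧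
      -- recurrence for the blocks of `P₋`
      block Pm 0 = 0 ∧
      (∀ n, block Pm (n + 1) = (1 / 2 : ℂ) • Matrix.reindex (halves n) (halves n)
        (Matrix.fromBlocks (block Pm n) 1 0 (block Pm n))) ∧
      -- block structure of `P₊`
      (∃ B : l2 →L[ℂ] l2, (∀ c : l2, (B c : HaarIndex → ℂ) = blockSum (block Pp) c) ∧
        ∀ f : L2, Pp f = T.symm (B (T f))) ∧
      (V 0).map (Pp : L2 →ₗ[ℂ] L2) = V 0 ∧
      (∀ n, (W n).map (Pp : L2 →ₗ[ℂ] L2) ≤ W n) ∧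
      -- recurrence for the blocks of `P₊`
      block Pp 0 = 0 ∧
      (∀ n, block Pp (n + 1) = (1 / 2 : ℂ) • Matrix.reindex (halves n) (halves n)
        (Matrix.fromBlocks (block Pp n) 0 1 (block Pp n))) ∧
      -- `P₋` and `P₊` are adjoints of each other
      ContinuousLinearMap.adjoint Pm = Pp ∧
      ContinuousLinearMap.adjoint Pp = Pm := by
  obtain ⟨Pm, hm, hPm⟩ := exists_hasBlocks_haarOp (a := 1) (b := 0) (by simp)
  obtain ⟨Pp, hp, hPp⟩ := exists_hasBlocks_haarOp (a := 0) (b := 1) (by simp)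
  refine ⟨haarBasis.repr, Pm, Pp, isHaarTransform_repr, fun f hf => ?_, hm.exists_blockSum,
    hm.map_V_zero, hm.map_W_le, ?_, fun n => ?_, hp.exists_blockSum, hp.map_V_zero, hp.map_W_le,
    ?_, fun n => ?_, adjoint_eq_of_hasBlocks hm (by simpa using hp),
    adjoint_eq_of_hasBlocks hp (by simpa using hm)⟩
  · rw [Pminus_eq_haarOp, Pplus_eq_haarOp]
    exact ⟨(hPm f hf).1, (hPm f hf).2, hPp f hf⟩
  · rw [hm.block_eq, blockMatrix]
  · rw [hm.block_eq, blockMatrix, one_smul, zero_smul]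
  · rw [hp.block_eq, blockMatrix]
  · rw [hp.block_eq, blockMatrix, one_smul, zero_smul]
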